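/- Let $\Sigma$ be a compact, smooth, $k$-dimensional ($k\ge 1$) immersed free boundary minimal submanifold of the closed unit ball $\overline{B^n}\subset\mathbb{R}^n$; that is, $\Sigma\subset \overline{B^n}$ has mean curvature zero, $\partial\Sigma\subset S^{n-1}$, and at every point of $\partial\Sigma$ the outward unit conormal vector of $\Sigma$ equals the position vector $x$. Let $v\in S^{n-1}$, and let $(f_t)_{t\in\mathbb{R}}$ be the one-parameter family of conformal transformations of the ball generated by the gradient on $S^{n-1}$ of the linear function $x\mapsto x\cdot v$; that is, $f_t$ is the flow on $\overline{B^n}$ of the conformal vector field $X(x)=\frac{1+|x|^2}{2}\,v-(x\cdot v)\,x$, which on $S^{n-1}$ equals the tangential part $v-(x\cdot v)x$ of $v$. Then the $(k-1)$-dimensional volume $|f_t(\partial\Sigma)|$ (of the immersed boundary, so counted with multiplicity) is differentiable in $t$, is twice differentiable at $t=0$, and $$\left.\frac{d^2}{dt^2}\right|_{t=0}|f_t(\partial\Sigma)| \;=\; -(k-1)\,k\int_{\Sigma}|v^\perp|^2\,dv_\Sigma\;\le\;0,$$ where $v^\perp$ denotes, at each point of $\Sigma$, the component of $v$ normal to $\Sigma$,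 and $dv_\Sigma$ is the $k$-dimensional volume element of $\Sigma$. -/

import Mathlib

open Set Filter MeasureTheory Metric
open scoped Manifold ContDiff Topology

noncomputable section

namespace FreeBoundary

section Submanifold

variable {m n : ℕ} {M : Type*} [TopologicalSpace M] [ChartedSpace (EuclideanHalfSpace (m + 1)) M]

/-- The map `F : M → ℝⁿ` read in the chart of `M` centred at `c`. -/
def inChart (c : M) (F : M → EuclideanSpace ℝ (Fin n)) :
    EuclideanSpace ℝ (Fin (m + 1)) → EuclideanSpace ℝ (Fin n) :=
  F ∘ (extChartAt (𝓡∂ (m + 1)) c).symm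

/-- The coordinate vector field `∂ᵢF`, in the chart centred at `c`, at the coordinates `x`. The
derivative is taken within the half-space, so that it makes sense up to the boundary. -/
def coordVec (c : M) (F : M → EuclideanSpace ℝ (Fin n)) (x : EuclideanSpace ℝ (Fin (m + 1)))
    (i : Fin (m + 1)) : EuclideanSpace ℝ (Fin n) :=
  fderivWithin ℝ (inChart c F) (range (𝓡∂ (m + 1))) x (EuclideanSpace.single i 1)

/-- The second coordinate derivative `∂ᵢ∂ⱼF`, in the chart centred at `c`, at the coordinates `x`. -/
def coordHess (c : M) (F : M → EuclideanSpace ℝ (Fin n)) (x : EuclideanSpace ℝ (Fin (m + 1)))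
    (i j : Fin (m + 1)) : EuclideanSpace ℝ (Fin n) :=
  iteratedFDerivWithin ℝ 2 (inChart c F) (range (𝓡∂ (m + 1))) x
    ![EuclideanSpace.single i 1, EuclideanSpace.single j 1]

/-- The mean curvature vector `H = ∑ᵢⱼ gⁱʲ (∂ᵢ∂ⱼF)^⊥` of the immersion `F` (the trace of its second
fundamental form with respect to the induced metric `gᵢⱼ = ⟨∂ᵢF, ∂ⱼF⟩`), computed in the chart
centred at `c`, at the coordinates `x`. -/
def meanCurvature (c : M) (F : M → EuclideanSpace ℝ (Fin n))
    (x : EuclideanSpace ℝ (Fin (m + 1))) : EuclideanSpace ℝ (Fin n) :=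
  ∑ i, ∑ j, (Matrix.gram ℝ (coordVec c F x))⁻¹ i j •
    (Submodule.span ℝ (range (coordVec c F x)))ᗮ.starProjection (coordHess c F x i j)

/-- `η` is the outward unit conormal, at the boundary point with coordinates `x` (so `x 0 = 0`) in
the chart centred at `c`, of the submanifold immersed by `F`: the unit vector that is tangent to
the submanifold, orthogonal to its boundary, and points out of the submanifold. (The first
coordinate is nonnegative on the half-space, so `∂₀F` points into the submanifold.) -/
structure IsOutwardConormal (c : M) (F : M → EuclideanSpace ℝ (Fin n))
    (x : EuclideanSpace ℝ (Fin (m + 1))) (η : EuclideanSpace ℝ (Fin n)) : Prop where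
  norm_eq_one : ‖η‖ = 1
  tangent : η ∈ Submodule.span ℝ (range (coordVec c F x))
  normal_boundary : ∀ i, i ≠ 0 → inner ℝ η (coordVec c F x i) = 0
  outward : inner ℝ η (coordVec c F x 0) < 0

/-- A smooth immersion `F : M → ℝⁿ` of an `(m + 1)`-dimensional manifold with boundary is a free
boundary minimal submanifold of the unit ball: the image lies in the closed ball, the boundary is
mapped to the unit sphere, the mean curvature vanishes, and along the boundary the outward unit
conormal is the position vector. -/
structure IsFreeBoundaryMinimal (F : M → EuclideanSpace ℝ (Fin n)) : Prop where
  smooth : ContMDiff (𝓡∂ (m + 1)) 𝓘(ℝ, EuclideanSpace ℝ (Fin n)) ∞ F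
  immersion : ∀ p, Function.Injective
    (mfderiv (𝓡∂ (m + 1)) 𝓘(ℝ, EuclideanSpace ℝ (Fin n)) F p)
  mem_ball : ∀ p, F p ∈ closedBall (0 : EuclideanSpace ℝ (Fin n)) 1
  mem_sphere : ∀ p ∈ (𝓡∂ (m + 1)).boundary M, F p ∈ sphere (0 : EuclideanSpace ℝ (Fin n)) 1
  minimal : ∀ c, ∀ p ∈ (chartAt (EuclideanHalfSpace (m + 1)) c).source,
    meanCurvature c F (extChartAt (𝓡∂ (m + 1)) c p) = 0
  conormal : ∀ c, ∀ p ∈ (chartAt (EuclideanHalfSpace (m + 1)) c).source,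
    p ∈ (𝓡∂ (m + 1)).boundary M →
      IsOutwardConormal c F (extChartAt (𝓡∂ (m + 1)) c p) (F p)

/-- The tangent space of the immersed submanifold at `p`, as a subspace of `ℝⁿ`. -/
def tangentPlane (m : ℕ) {n : ℕ} {M : Type*} [TopologicalSpace M]
    [ChartedSpace (EuclideanHalfSpace (m + 1)) M] (F : M → EuclideanSpace ℝ (Fin n)) (p : M) :
    Submodule ℝ (EuclideanSpace ℝ (Fin n)) :=
  LinearMap.range
    (mfderiv (𝓡∂ (m + 1)) 𝓘(ℝ, EuclideanSpace ℝ (Fin n)) F p).toLinearMap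

/-- The component `v^⊥` of `v` normal to the immersed submanifold at `p`. -/
def normalPart (m : ℕ) {n : ℕ} {M : Type*} [TopologicalSpace M]
    [ChartedSpace (EuclideanHalfSpace (m + 1)) M] (F : M → EuclideanSpace ℝ (Fin n)) (p : M)
    (v : EuclideanSpace ℝ (Fin n)) : EuclideanSpace ℝ (Fin n) :=
  (tangentPlane m F p)ᗮ.starProjection v

end Submanifold

section Volume

variable (m : ℕ) {n : ℕ} {M : Type*} [TopologicalSpace M]
  [ChartedSpace (EuclideanHalfSpace (m + 1)) M] [IsManifold (𝓡∂ (m + 1)) ∞ M]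
  [T2Space M] [SigmaCompactSpace M]

/-- A smooth partition of unity subordinate to the charts of `M`. -/
def chartPartition (M : Type*) [TopologicalSpace M]
    [ChartedSpace (EuclideanHalfSpace (m + 1)) M] [IsManifold (𝓡∂ (m + 1)) ∞ M]
    [T2Space M] [SigmaCompactSpace M] : SmoothPartitionOfUnity M (𝓡∂ (m + 1)) M univ :=
  (SmoothPartitionOfUnity.exists_isSubordinate_chartAt_source (𝓡∂ (m + 1)) M).choose

theorem chartPartition_isSubordinate :
    (chartPartition m M).IsSubordinate
      (fun c => (chartAt (EuclideanHalfSpace (m + 1)) c).source) :=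
  (SmoothPartitionOfUnity.exists_isSubordinate_chartAt_source (𝓡∂ (m + 1)) M).choose_spec

/-- The inclusion `y ↦ (0, y)` of `ℝᵐ` as the boundary of the half-space in `ℝ^{m+1}`. -/
def toBoundary (y : EuclideanSpace ℝ (Fin m)) : EuclideanSpace ℝ (Fin (m + 1)) :=
  WithLp.toLp 2 (Fin.cons 0 (y : Fin m → ℝ))

variable [MeasurableSpace M]

/-- The `(m + 1)`-dimensional Riemannian volume measure on `M` of the metric induced by
`F : M → ℝⁿ`: in a chart it has the density `√det(⟨∂ᵢF, ∂ⱼF⟩)` with respect to Lebesgue measure, and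
the charts are put together by a partition of unity. If `F` is not injective, the volume of the
image is counted with multiplicity. -/
def volumeMeasure (F : M → EuclideanSpace ℝ (Fin n)) : Measure M :=
  Measure.sum fun c : M =>
    ((volume.restrict (extChartAt (𝓡∂ (m + 1)) c).target).withDensity fun x =>
      ENNReal.ofReal (chartPartition m M c ((extChartAt (𝓡∂ (m + 1)) c).symm x) *
        (fderivWithin ℝ (inChart c F) (range (𝓡∂ (m + 1))) x).toLinearMap.normDet)).map
    (extChartAt (𝓡∂ (m + 1)) c).symm

/-- The `m`-dimensional Riemannian volume measure, on the boundary of `M`, of the metric induced by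
the restriction of `F : M → ℝⁿ` to the boundary; it is the same construction as above, in the
charts `y ↦ (0, y)` of the boundary. (For `m = 0` it counts the points of the boundary.) -/
def boundaryMeasure (F : M → EuclideanSpace ℝ (Fin n)) : Measure M :=
  Measure.sum fun c : M =>
    ((volume.restrict (toBoundary m ⁻¹' (extChartAt (𝓡∂ (m + 1)) c).target)).withDensity fun y =>
      ENNReal.ofReal
        (chartPartition m M c ((extChartAt (𝓡∂ (m + 1)) c).symm (toBoundary m y)) *
          (fderiv ℝ (inChart c F ∘ toBoundary m) y).toLinearMap.normDet)).map
    ((extChartAt (𝓡∂ (m + 1)) c).symm ∘ toBoundary m)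

/-- The volume `|F(∂M)|` of the boundary. -/
def boundaryVolume (F : M → EuclideanSpace ℝ (Fin n)) : ℝ :=
  (boundaryMeasure m F).real univ

end Volume

section Flow

variable {n : ℕ}

/-- The conformal vector field of the ball that extends the gradient, on the unit sphere, of the
linear function `x ↦ ⟨x, v⟩`. -/
def conformalField (v x : EuclideanSpace ℝ (Fin n)) : EuclideanSpace ℝ (Fin n) :=
  ((1 + ‖x‖ ^ 2) / 2) • v - inner ℝ x v • x

/-- On the unit sphere the field is the component of `v` tangent to the sphere, that is, the
spherical gradient of `x ↦ ⟨x, v⟩`. -/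
theorem conformalField_eq_gradient {v x : EuclideanSpace ℝ (Fin n)}
    (hx : x ∈ sphere (0 : EuclideanSpace ℝ (Fin n)) 1) :
    conformalField v x = (Submodule.span ℝ {x})ᗮ.starProjection v := by
  have hx1 : ‖x‖ = 1 := by simpa using hx
  rw [Submodule.starProjection_orthogonal_val,
    Submodule.starProjection_unit_singleton ℝ hx1, conformalField, hx1]
  norm_num

/-- `f` is the one-parameter family of conformal transformations of the closed unit ball generated
by the gradient of `x ↦ ⟨x, v⟩`, that is, the flow of `conformalField v`. -/
structure IsConformalFlow (v : EuclideanSpace ℝ (Fin n))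
    (f : ℝ → EuclideanSpace ℝ (Fin n) → EuclideanSpace ℝ (Fin n)) : Prop where
  zero : ∀ x ∈ closedBall (0 : EuclideanSpace ℝ (Fin n)) 1, f 0 x = x
  hasDerivAt : ∀ x ∈ closedBall (0 : EuclideanSpace ℝ (Fin n)) 1, ∀ t,
    HasDerivAt (fun s => f s x) (conformalField v (f t x)) t

/-- Numerator of the explicit flow. -/
def flowNum (v : EuclideanSpace ℝ (Fin n)) (t : ℝ) (x : EuclideanSpace ℝ (Fin n)) :
    EuclideanSpace ℝ (Fin n) :=
  x + ((1 + ‖x‖ ^ 2) / 2 * Real.sinh t + inner ℝ x v * (Real.cosh t - 1)) • v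

/-- Denominator of the explicit flow. -/
def flowDen (v : EuclideanSpace ℝ (Fin n)) (t : ℝ) (x : EuclideanSpace ℝ (Fin n)) : ℝ :=
  (1 + ‖x‖ ^ 2) / 2 * Real.cosh t + inner ℝ x v * Real.sinh t + (1 - ‖x‖ ^ 2) / 2

theorem flowDen_pos {v : EuclideanSpace ℝ (Fin n)} (hv : ‖v‖ = 1) (t : ℝ)
    {x : EuclideanSpace ℝ (Fin n)} (hx : ‖x‖ ≤ 1) : 0 < flowDen v t x := by
  have h1 : |inner ℝ x v| ≤ ‖x‖ := by simpa [hv] using abs_real_inner_le_norm x v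
  have h2 := abs_le.1 h1
  have h3 := Real.cosh_sq t
  have h4 := Real.cosh_pos t
  have h5 : |Real.sinh t| < Real.cosh t := by
    apply abs_lt_of_sq_lt_sq _ h4.le
    linarith
  have h6 := abs_lt.1 h5
  have h7 := norm_nonneg x
  have h8 : |inner ℝ x v * Real.sinh t| ≤ ‖x‖ * |Real.sinh t| := by
    rw [abs_mul]; gcongr
  have h9 := (abs_le.1 h8).1
  have h10 := abs_nonneg (Real.sinh t)
  unfold flowDen
  nlinarith [sq_nonneg (1 - ‖x‖), sq_nonneg ‖x‖]

theorem norm_flowNum_sq {v : EuclideanSpace ℝ (Fin n)} (hv : ‖v‖ = 1) (t : ℝ)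
    (x : EuclideanSpace ℝ (Fin n)) :
    ‖flowNum v t x‖ ^ 2 = flowDen v t x * (flowDen v t x - (1 - ‖x‖ ^ 2)) := by
  have h := Real.cosh_sq t
  unfold flowNum flowDen
  rw [norm_add_sq_real, norm_smul, hv, inner_smul_right, mul_one, Real.norm_eq_abs, sq_abs]
  linear_combination ((1 + ‖x‖ ^ 2) ^ 2 / 4 - (inner ℝ x v) ^ 2) * (-h)

theorem inner_flowNum {v : EuclideanSpace ℝ (Fin n)} (hv : ‖v‖ = 1) (t : ℝ)
    (x : EuclideanSpace ℝ (Fin n)) :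
    inner ℝ (flowNum v t x) v = (1 + ‖x‖ ^ 2) / 2 * Real.sinh t + inner ℝ x v * Real.cosh t := by
  unfold flowNum
  rw [inner_add_left, real_inner_smul_left, real_inner_self_eq_norm_sq, hv]
  ring

/-- The flow exists: it is the family of Möbius transformations `flowNum / flowDen`. -/
theorem isConformalFlow_explicit {v : EuclideanSpace ℝ (Fin n)} (hv : ‖v‖ = 1) :
    IsConformalFlow v fun t x => (flowDen v t x)⁻¹ • flowNum v t x where
  zero x _ := by
    have h : flowDen v 0 x = 1 := by simp [flowDen]; ring
    simp [h, flowNum]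
  hasDerivAt x hx t := by
    have hx1 : ‖x‖ ≤ 1 := by simpa using hx
    have hD := flowDen_pos hv t hx1
    have hDne : flowDen v t x ≠ 0 := hD.ne'
    have h1 : HasDerivAt (fun s => flowDen v s x)
        ((1 + ‖x‖ ^ 2) / 2 * Real.sinh t + inner ℝ x v * Real.cosh t) t := by
      unfold flowDen
      exact (((Real.hasDerivAt_cosh t).const_mul _).add
        ((Real.hasDerivAt_sinh t).const_mul _)).add_const _
    have h2 : HasDerivAt (fun s => flowNum v s x)
        (((1 + ‖x‖ ^ 2) / 2 * Real.cosh t + inner ℝ x v * Real.sinh t) • v) t := by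
      unfold flowNum
      exact ((((Real.hasDerivAt_sinh t).const_mul _).add
        (((Real.hasDerivAt_cosh t).sub_const 1).const_mul _)).smul_const v).const_add x
    refine ((h1.inv hDne).smul h2).congr_deriv ?_
    unfold conformalField
    rw [norm_smul, mul_pow, norm_flowNum_sq hv, real_inner_smul_left, inner_flowNum hv, norm_inv,
      Real.norm_eq_abs, inv_pow, sq_abs, smul_smul, smul_smul, sub_eq_add_neg, ← neg_smul]
    congr 2
    · have hd : flowDen v t x = (1 + ‖x‖ ^ 2) / 2 * Real.cosh t + inner ℝ x v * Real.sinh t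
          + (1 - ‖x‖ ^ 2) / 2 := rfl
      have : (1 + ‖x‖ ^ 2) / 2 * Real.cosh t + inner ℝ x v * Real.sinh t
          = flowDen v t x - (1 - ‖x‖ ^ 2) / 2 := by rw [hd]; ring
      rw [this]
      simp only [Pi.inv_apply]
      field_simp
      ring
    · field_simp

/-- The flow preserves the closed ball. -/
theorem norm_flow_le_one {v : EuclideanSpace ℝ (Fin n)} (hv : ‖v‖ = 1) (t : ℝ)
    {x : EuclideanSpace ℝ (Fin n)} (hx : ‖x‖ ≤ 1) :
    ‖(flowDen v t x)⁻¹ • flowNum v t x‖ ≤ 1 := by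
  have hD := flowDen_pos hv t hx
  rw [norm_smul, norm_inv, Real.norm_eq_abs, abs_of_pos hD, inv_mul_le_one₀ hD]
  refine abs_le_of_sq_le_sq' ?_ hD.le |>.2
  rw [norm_flowNum_sq hv]
  have : ‖x‖ ^ 2 ≤ 1 := pow_le_one₀ (norm_nonneg x) hx
  nlinarith

/-- The flow consists of conformal maps. -/
theorem conformalAt_flow {v : EuclideanSpace ℝ (Fin n)} (hv : ‖v‖ = 1) (t : ℝ)
    {x : EuclideanSpace ℝ (Fin n)} (hx : ‖x‖ ≤ 1) :
    ConformalAt (fun y => (flowDen v t y)⁻¹ • flowNum v t y) x := by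
  have hD := flowDen_pos hv t hx
  have hDne : flowDen v t x ≠ 0 := hD.ne'
  have hq : HasFDerivAt (fun y : EuclideanSpace ℝ (Fin n) => ‖y‖ ^ 2) (2 • innerSL ℝ x) x :=
    (hasStrictFDerivAt_norm_sq x).hasFDerivAt
  have hl : HasFDerivAt (fun y : EuclideanSpace ℝ (Fin n) => (inner ℝ y v : ℝ)) (innerSL ℝ v) x := by
    refine ((innerSL ℝ v).hasFDerivAt (x := x)).congr_of_eventuallyEq (Eventually.of_forall ?_)
    intro y
    simp [real_inner_comm]
  have h1 : HasFDerivAt (flowDen v t) ((Real.cosh t - 1) • innerSL ℝ x + Real.sinh t • innerSL ℝ v)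
      x := by
    unfold flowDen
    refine ((((hq.const_add 1).mul_const (2⁻¹ * Real.cosh t)).add (hl.mul_const (Real.sinh t))).add
      ((hq.const_sub 1).mul_const (2⁻¹))).congr_fderiv ?_ |>.congr_of_eventuallyEq
      (Eventually.of_forall ?_)
    · ext h
      simp
      ring
    · intro y
      simp
      ring
  have h2 : HasFDerivAt (flowNum v t) (ContinuousLinearMap.id ℝ _ +
      (Real.sinh t • innerSL ℝ x + (Real.cosh t - 1) • innerSL ℝ v).smulRight v) x := by
    unfold flowNum
    refine (hasFDerivAt_id x).add (HasFDerivAt.smul_const ?_ v)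
    refine (((hq.const_add 1).mul_const (2⁻¹ * Real.sinh t)).add
      (hl.mul_const (Real.cosh t - 1))).congr_fderiv ?_ |>.congr_of_eventuallyEq
      (Eventually.of_forall ?_)
    · ext h
      simp
      ring
    · intro y
      simp
      ring
  have h3 : HasFDerivAt (fun y => (flowDen v t y)⁻¹ • flowNum v t y) _ x :=
    ((hasDerivAt_inv hDne).comp_hasFDerivAt x h1).smul h2
  rw [conformalAt_iff', h3.fderiv]
  refine ⟨(flowDen v t x ^ 2)⁻¹, by positivity, fun a b => ?_⟩
  have hc := Real.cosh_sq t
  have hN := norm_flowNum_sq hv t x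
  rw [← real_inner_self_eq_norm_sq] at hN
  have hpol : ∀ a : EuclideanSpace ℝ (Fin n), inner ℝ (flowNum v t x)
      (a + (Real.sinh t * inner ℝ x a + (Real.cosh t - 1) * inner ℝ v a) • v) =
      ((Real.cosh t - 1) * inner ℝ x a + Real.sinh t * inner ℝ v a) *
        (flowDen v t x - (1 - ‖x‖ ^ 2) / 2) + flowDen v t x * inner ℝ x a := by
    intro a
    rw [inner_add_right, real_inner_smul_right, inner_flowNum hv]
    unfold flowNum flowDen
    rw [inner_add_left, real_inner_smul_left]
    linear_combination (-(1 + ‖x‖ ^ 2) / 2 * inner ℝ x a + inner ℝ x v * inner ℝ v a) * hc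
  have hab : inner ℝ (a + (Real.sinh t * inner ℝ x a + (Real.cosh t - 1) * inner ℝ v a) • v)
      (b + (Real.sinh t * inner ℝ x b + (Real.cosh t - 1) * inner ℝ v b) • v) =
      inner ℝ a b + ((Real.cosh t - 1) * inner ℝ x a + Real.sinh t * inner ℝ v a) *
        ((Real.cosh t - 1) * inner ℝ x b + Real.sinh t * inner ℝ v b)
      + ((Real.cosh t - 1) * inner ℝ x a + Real.sinh t * inner ℝ v a) * inner ℝ x b
      + ((Real.cosh t - 1) * inner ℝ x b + Real.sinh t * inner ℝ v b) * inner ℝ x a := by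
    rw [inner_add_left, inner_add_right, inner_add_right, real_inner_smul_left,
      real_inner_smul_left, real_inner_smul_right, real_inner_smul_right,
      real_inner_self_eq_norm_sq, hv, real_inner_comm v a]
    linear_combination (inner ℝ v a * inner ℝ v b - inner ℝ x a * inner ℝ x b) * hc
  have happ : ∀ a : EuclideanSpace ℝ (Fin n),
      (((fun y => y⁻¹) ∘ flowDen v t) x •
        (ContinuousLinearMap.id ℝ (EuclideanSpace ℝ (Fin n)) +
          (Real.sinh t • innerSL ℝ x + (Real.cosh t - 1) • innerSL ℝ v).smulRight v) +
      (-(flowDen v t x ^ 2)⁻¹ • ((Real.cosh t - 1) • innerSL ℝ x +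
        Real.sinh t • innerSL ℝ v)).smulRight (flowNum v t x)) a =
      (flowDen v t x)⁻¹ •
        (a + (Real.sinh t * inner ℝ x a + (Real.cosh t - 1) * inner ℝ v a) • v) +
      (-(flowDen v t x ^ 2)⁻¹ * ((Real.cosh t - 1) * inner ℝ x a + Real.sinh t * inner ℝ v a)) •
        flowNum v t x := by
    intro a
    simp
    module
  rw [happ, happ, inner_add_left, inner_add_right, inner_add_right]
  simp only [real_inner_smul_left, real_inner_smul_right]
  rw [hab, hN, hpol, real_inner_comm (flowNum v t x) (a + _), hpol]
  field_simp
  ring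

end Flow

end FreeBoundary

end

/-!
The volume of the moved boundary is computed on the original boundary, and its second derivative is
then identified with the flux of a linear vector field.

On the unit sphere the map `f t` is conformal with factor `(cosh t + ⟨x, v⟩ sinh t)⁻¹`
(`exists_hasFDerivAt_flow_comp`; the flow `f` agrees with the explicit one by uniqueness of
trajectories, `IsConformalFlow.eq_of_mem`). Since `∂M` is mapped to the sphere, the volume of
`f t (∂M)` is `∫ (cosh t + ⟨u, v⟩ sinh t)⁻ᵐ` over `∂M` (`boundaryVolume_flow`). Differentiation
under the integral sign (`hasDerivAt_integral_comp`) gives the second derivative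
`m ∫ ((m + 1) ⟨u, v⟩² - 1)` at `t = 0`. As `|u| = 1` on `∂M` and the conormal is `u`, this is `m`
times the flux through `∂M` of the linear field `X = (m + 1) ⟨x, v⟩ v - x`. On a minimal submanifold
that flux is the integral of the tangential divergence of `X`
(`integral_boundary_eq_neg_integral_normalPart`), and this divergence is
`(m + 1) |v^⊤|² - (m + 1) = -(m + 1) |v^⊥|²` (`sum_inner_field_dualFrame`).

The divergence theorem is proved for `ρ X`, with `ρ` a member of the partition of unity supported in
one chart (`chartIntegral_divergence`). With the coordinate frame `eᵢ = ∂ᵢu` and its dual frame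
`eⁱ`, the coordinate flux densities are `ρ ⟨X, √g eⁱ⟩`. Minimality says exactly that the weighted
dual frame is divergence-free, `∑ᵢ ∂ᵢ(√g eⁱ) = 0` (`hasFDerivAt_fluxFrame_of_minimal`): the tangential
part of this identity is Jacobi's formula for `∂ₖ√g`, the normal part is the vanishing of the mean
curvature. Hence the divergence of the flux only involves first derivatives of `u` and of `ρ`, and
the divergence theorem in the half-space applies (`integral_divergence_halfSpace`). At the boundary
`√g e⁰` is minus the conormal times the boundary density (`sqrt_det_gram_smul_dualFrame_zero`). The
terms with derivatives of `ρ` add up to zero over the partition of unity, because integrals of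
functions supported in two charts agree in both (`sum_chartIntegral_tangentialDeriv`,
`chartIntegral_eq_of_support`).
-/

noncomputable section

namespace FreeBoundary

/-! ### Gram matrices and dual frames -/

theorem inner_eq_zero_of_mem_span {ι V : Type*} [NormedAddCommGroup V]
    [InnerProductSpace ℝ V] {e : ι → V} {z : V} (hz : ∀ k, inner ℝ z (e k) = 0) {w : V}
    (hw : w ∈ Submodule.span ℝ (range e)) : inner ℝ z w = 0 := by
  induction hw using Submodule.span_induction with
  | mem x hx => obtain ⟨k, rfl⟩ := hx; exact hz k
  | zero => simp
  | add x y _ _ hx hy => rw [inner_add_right, hx, hy, add_zero]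
  | smul a x _ hx => rw [real_inner_smul_right, hx, mul_zero]

section Gram

variable {ι : Type*} [Fintype ι] [DecidableEq ι]
  {V : Type*} [NormedAddCommGroup V] [InnerProductSpace ℝ V]

/-- The frame `eⁱ = ∑ⱼ gⁱʲ eⱼ` dual to a frame `eⱼ` of a subspace. -/
def dualFrame (e : ι → V) (i : ι) : V := ∑ j, (Matrix.gram ℝ e)⁻¹ i j • e j

theorem det_gram_pos {e : ι → V} (he : LinearIndependent ℝ e) : 0 < (Matrix.gram ℝ e).det :=
  (Matrix.posDef_gram_of_linearIndependent he).det_pos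

theorem inner_dualFrame {e : ι → V} (he : (Matrix.gram ℝ e).det ≠ 0) (i k : ι) :
    inner ℝ (dualFrame e i) (e k) = if i = k then 1 else 0 := by
  have h := Matrix.nonsing_inv_mul (Matrix.gram ℝ e) (isUnit_iff_ne_zero.2 he)
  have h' := congrFun (congrFun h i) k
  simpa [dualFrame, sum_inner, real_inner_smul_left, Matrix.mul_apply, Matrix.gram_apply,
    Matrix.one_apply] using h'

theorem dualFrame_mem_span (e : ι → V) (i : ι) :
    dualFrame e i ∈ Submodule.span ℝ (range e) :=
  Submodule.sum_mem _ fun j _ => Submodule.smul_mem _ _ (Submodule.subset_span ⟨j, rfl⟩)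

/-- Expansion of the orthogonal projection onto the span of a frame, by the dual frame. -/
theorem sum_inner_dualFrame_smul [FiniteDimensional ℝ V] {e : ι → V}
    (he : (Matrix.gram ℝ e).det ≠ 0) (X : V) :
    ∑ i, (inner ℝ X (dualFrame e i) : ℝ) • e i =
      (Submodule.span ℝ (range e)).starProjection X := by
  refine (Submodule.eq_starProjection_of_mem_of_inner_eq_zero ?_ ?_).symm
  · exact Submodule.sum_mem _ fun j _ => Submodule.smul_mem _ _ (Submodule.subset_span ⟨j, rfl⟩)
  · intro w hw
    refine inner_eq_zero_of_mem_span (fun k => ?_) hw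
    have h := Matrix.mul_nonsing_inv (Matrix.gram ℝ e) (isUnit_iff_ne_zero.2 he)
    have h1 : ∀ j, ∑ i, inner ℝ (e i) (e k) * (Matrix.gram ℝ e)⁻¹ i j = if k = j then 1 else 0 := by
      intro j
      have h' := congrFun (congrFun h k) j
      simpa [Matrix.mul_apply, Matrix.gram_apply, Matrix.one_apply, real_inner_comm] using h'
    rw [inner_sub_left, sum_inner, sub_eq_zero]
    simp only [real_inner_smul_left, dualFrame, inner_sum, real_inner_smul_right, Finset.sum_mul]
    rw [Finset.sum_comm]
    calc (inner ℝ X (e k) : ℝ) = ∑ j, (if k = j then 1 else 0) * inner ℝ X (e j) := by simp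
      _ = _ := by
        refine Finset.sum_congr rfl fun j _ => ?_
        rw [← h1 j, Finset.sum_mul]
        refine Finset.sum_congr rfl fun i _ => ?_
        ring

/-- The tangential divergence of the linear field `x ↦ c ⟨x, v⟩ v - x`. -/
theorem sum_inner_field_dualFrame [FiniteDimensional ℝ V] {e : ι → V}
    (he : (Matrix.gram ℝ e).det ≠ 0) {v : V} (hv : ‖v‖ = 1) :
    ∑ i, inner ℝ (((Fintype.card ι : ℝ) * inner ℝ (e i) v) • v - e i) (dualFrame e i) =
      -((Fintype.card ι : ℝ) * ‖(Submodule.span ℝ (range e))ᗮ.starProjection v‖ ^ 2) := by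
  have h1 : ∑ i, inner ℝ v (dualFrame e i) * inner ℝ (e i) v =
      ‖(Submodule.span ℝ (range e)).starProjection v‖ ^ 2 := by
    have := Submodule.re_inner_starProjection_eq_normSq (K := Submodule.span ℝ (range e)) v
    rw [RCLike.re_to_real] at this
    change _ = ‖(Submodule.span ℝ (range e)).starProjection v‖ ^ 2 at this
    rw [← this, ← sum_inner_dualFrame_smul he v, sum_inner]
    simp [real_inner_smul_left]
  have h2 := Submodule.norm_sq_eq_add_norm_sq_starProjection v (Submodule.span ℝ (range e))
  rw [hv] at h2
  have h3 : ∀ i, inner ℝ (e i) (dualFrame e i) = (1 : ℝ) := fun i => by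
    rw [real_inner_comm, inner_dualFrame he, if_pos rfl]
  simp only [inner_sub_left, real_inner_smul_left, h3]
  rw [Finset.sum_sub_distrib]
  have h4 : ∑ i, (Fintype.card ι : ℝ) * inner ℝ (e i) v * inner ℝ v (dualFrame e i) =
      Fintype.card ι * ‖(Submodule.span ℝ (range e)).starProjection v‖ ^ 2 := by
    rw [← h1, Finset.mul_sum]
    exact Finset.sum_congr rfl fun i _ => by ring
  rw [h4, Finset.sum_const, Finset.card_univ, nsmul_eq_mul, mul_one]
  linear_combination (-(Fintype.card ι : ℝ)) * h2

theorem normDet_eq_sqrt_det_gram {U : Type*} [NormedAddCommGroup U] [InnerProductSpace ℝ U]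
    [FiniteDimensional ℝ U] (f : U →ₗ[ℝ] V) (b : OrthonormalBasis ι ℝ U) :
    f.normDet = √(Matrix.gram ℝ fun i => f (b i)).det := by
  have h := f.normDet_sq_eq_det_gram b
  rw [← h]
  simp [Real.sqrt_sq f.normDet_nonneg]

end Gram

/-- Along the boundary, the first vector of the dual frame, weighted by the volume density, is
minus the outward conormal weighted by the volume density of the boundary. -/
theorem sqrt_det_gram_smul_dualFrame_zero {m : ℕ} {V : Type*} [NormedAddCommGroup V]
    [InnerProductSpace ℝ V] {e : Fin (m + 1) → V}
    (he : 0 < (Matrix.gram ℝ e).det) {η : V} (h1 : ‖η‖ = 1)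
    (hη : η ∈ Submodule.span ℝ (range e)) (hn : ∀ i, i ≠ 0 → inner ℝ η (e i) = 0)
    (ho : inner ℝ η (e 0) < 0) :
    √(Matrix.gram ℝ e).det • dualFrame e 0 =
      -(√(Matrix.gram ℝ fun i : Fin m => e i.succ).det • η) := by
  set a : ℝ := inner ℝ η (e 0) with ha
  have hane : a ≠ 0 := ho.ne
  -- Both vectors lie in the span and have the same inner products with the frame.
  have hd : dualFrame e 0 = a⁻¹ • η := by
    have hmem : dualFrame e 0 - a⁻¹ • η ∈ Submodule.span ℝ (range e) :=
      Submodule.sub_mem _ (dualFrame_mem_span e 0) (Submodule.smul_mem _ _ hη)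
    have hz : ∀ k, inner ℝ (dualFrame e 0 - a⁻¹ • η) (e k) = 0 := by
      intro k
      rw [inner_sub_left, inner_dualFrame he.ne', real_inner_smul_left]
      rcases eq_or_ne k 0 with rfl | hk
      · simp [← ha, hane]
      · simp [hn k hk, hk.symm]
    have := inner_eq_zero_of_mem_span hz hmem
    rwa [inner_self_eq_zero, sub_eq_zero] at this
  -- Comparing `|e⁰|² = g⁰⁰ = a⁻²` with the cofactor formula for `g⁰⁰` relates the two determinants.
  have h00 : (Matrix.gram ℝ e)⁻¹ 0 0 = (a⁻¹) ^ 2 := by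
    have h2 : inner ℝ (dualFrame e 0) (dualFrame e 0) = (Matrix.gram ℝ e)⁻¹ 0 0 := by
      conv_lhs => arg 3; rw [dualFrame]
      rw [inner_sum]
      simp [real_inner_smul_right, inner_dualFrame he.ne']
    rw [← h2, hd, real_inner_smul_left, real_inner_smul_right, real_inner_self_eq_norm_sq, h1]
    ring
  have hadj : (Matrix.gram ℝ e).adjugate 0 0 = (Matrix.gram ℝ fun i : Fin m => e i.succ).det := by
    rw [Matrix.adjugate_fin_succ_eq_det_submatrix]
    simp
    rfl
  have hdet : (Matrix.gram ℝ fun i : Fin m => e i.succ).det =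
      (a⁻¹) ^ 2 * (Matrix.gram ℝ e).det := by
    rw [← hadj, ← h00, Matrix.inv_def]
    simp [mul_comm, he.ne']
  rw [hdet, hd, Real.sqrt_mul (sq_nonneg _), Real.sqrt_sq_eq_abs, abs_of_neg (inv_lt_zero.2 ho),
    smul_smul, ← neg_smul]
  congr 1
  ring

/-! ### The derivative of a determinant -/

section Det

variable {ι : Type*} [Fintype ι] [DecidableEq ι] {E : Type*} [NormedAddCommGroup E]
  [NormedSpace ℝ E]

/-- Jacobi's formula. -/
theorem hasFDerivAt_det {A : E → Matrix ι ι ℝ} {A' : ι → ι → E →L[ℝ] ℝ} {x : E}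
    (hA : ∀ i j, HasFDerivAt (fun y => A y i j) (A' i j) x) :
    HasFDerivAt (fun y => (A y).det) (∑ i, ∑ j, (A x).adjugate j i • A' i j) x := by
  let D : ContinuousMultilinearMap ℝ (fun _ : ι => ι → ℝ) ℝ :=
    { (Matrix.detRowAlternating (R := ℝ) (n := ι)).toMultilinearMap with
      cont := (continuous_id (X := Matrix ι ι ℝ)).matrix_det }
  have h := HasFDerivAt.multilinear_comp (f := D) (g := fun i y => A y i)
    (g' := fun i => ContinuousLinearMap.pi (A' i)) (x := x)
    (fun i => hasFDerivAt_pi.2 fun j => hA i j)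
  refine h.congr_fderiv ?_
  ext w
  simp only [sum_apply, ContinuousLinearMap.comp_apply, smul_apply, smul_eq_mul]
  refine Finset.sum_congr rfl fun i _ => ?_
  have h2 := Matrix.cramer_transpose_apply (A x) (fun j => A' i j w) i
  rw [Matrix.cramer_eq_adjugate_mulVec, ← Matrix.adjugate_transpose] at h2
  simp only [Matrix.mulVec, dotProduct, Matrix.transpose_apply] at h2
  exact h2.symm

theorem _root_.ContDiffWithinAt.matrix_det {A : E → Matrix ι ι ℝ} {x : E} {s : Set E}
    {k : WithTop ℕ∞}
    (hA : ∀ i j, ContDiffWithinAt ℝ k (fun y => A y i j) s x) :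
    ContDiffWithinAt ℝ k (fun y => (A y).det) s x := by
  simp only [Matrix.det_apply]
  refine ContDiffWithinAt.sum fun σ _ => ?_
  refine ContDiffWithinAt.const_smul _ (contDiffWithinAt_prod fun i _ => hA _ _)

theorem _root_.ContDiffWithinAt.matrix_inv {A : E → Matrix ι ι ℝ} {x : E} {s : Set E}
    {k : WithTop ℕ∞}
    (hA : ∀ i j, ContDiffWithinAt ℝ k (fun y => A y i j) s x) (h0 : (A x).det ≠ 0) (i j : ι) :
    ContDiffWithinAt ℝ k (fun y => (A y)⁻¹ i j) s x := by
  have h : (fun y => (A y)⁻¹ i j) = fun y => (A y).det⁻¹ * (A y).adjugate i j := by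
    funext y
    simp [Matrix.inv_def]
  rw [h]
  refine ((ContDiffWithinAt.matrix_det hA).inv h0).mul ?_
  simp only [Matrix.adjugate_apply]
  refine ContDiffWithinAt.matrix_det fun a b => ?_
  simp only [Matrix.updateRow_apply]
  split_ifs
  · exact contDiffWithinAt_const
  · exact hA a b

end Det

/-! ### Minimality as a divergence identity -/

section Minimal

variable {ι : Type*} [Fintype ι] [DecidableEq ι] {E : Type*} [NormedAddCommGroup E]
  [NormedSpace ℝ E] {V : Type*} [NormedAddCommGroup V] [InnerProductSpace ℝ V]

/-- The dual frame weighted by the volume density, `√g eⁱ`. For a coordinate frame of an immersed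
submanifold, a vector field of `ℝⁿ` has flux density `⟨X, √g eⁱ⟩` through the coordinate
hypersurfaces. -/
def fluxFrame (e : ι → V) (i : ι) : V := √(Matrix.gram ℝ e).det • dualFrame e i

/-- The derivative of the volume density in a coordinate direction. -/
theorem hasFDerivAt_sqrt_det_gram {e : E → ι → V} {e' : ι → E →L[ℝ] V} {x : E}
    (he : ∀ i, HasFDerivAt (fun y => e y i) (e' i) x) (hdet : 0 < (Matrix.gram ℝ (e x)).det) :
    ∃ s' : E →L[ℝ] ℝ, HasFDerivAt (fun y => √(Matrix.gram ℝ (e y)).det) s' x ∧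
      ∀ w, s' w = ∑ i, inner ℝ (fluxFrame (e x) i) (e' i w) := by
  have hg : ∀ i j, HasFDerivAt (fun y => Matrix.gram ℝ (e y) i j)
      ((fderivInnerCLM ℝ (e x i, e x j)).comp ((e' i).prod (e' j))) x := fun i j =>
    (he i).inner ℝ (he j)
  have hs := (hasFDerivAt_det hg).sqrt hdet.ne'
  refine ⟨_, hs, fun w => ?_⟩
  set G := Matrix.gram ℝ (e x) with hG
  have hadj : G.adjugate = G.det • G⁻¹ := by
    rw [Matrix.inv_def, smul_smul, Ring.inverse_eq_inv', mul_inv_cancel₀ hdet.ne', one_smul]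
  have hsymm : ∀ i j, G⁻¹ j i = G⁻¹ i j := fun i j => by
    have h := (Matrix.isHermitian_gram ℝ (e x)).inv
    simpa using (h.apply i j)
  have hsq : √G.det * √G.det = G.det := Real.mul_self_sqrt hdet.le
  have hspos : 0 < √G.det := Real.sqrt_pos.2 hdet
  have h1 : ∀ i, inner ℝ (fluxFrame (e x) i) (e' i w) =
      √G.det * ∑ j, G⁻¹ i j * inner ℝ (e x j) (e' i w) := by
    intro i
    rw [fluxFrame, real_inner_smul_left, dualFrame, sum_inner]
    simp only [real_inner_smul_left, hG]
  simp only [h1, hadj, smul_apply, sum_apply, ContinuousLinearMap.comp_apply,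
    ContinuousLinearMap.prod_apply, fderivInnerCLM_apply, smul_eq_mul, Matrix.smul_apply]
  rw [← Finset.mul_sum]
  have h2 : ∑ i, ∑ j, G.det * G⁻¹ j i * (inner ℝ (e x i) (e' j w) + inner ℝ (e' i w) (e x j)) =
      2 * (G.det * ∑ i, ∑ j, G⁻¹ i j * inner ℝ (e x j) (e' i w)) := by
    simp only [mul_add, Finset.sum_add_distrib, two_mul]
    congr 1
    · rw [Finset.sum_comm, Finset.mul_sum]
      simp only [Finset.mul_sum, mul_assoc]
    · simp only [Finset.mul_sum]
      refine Finset.sum_congr rfl fun i _ => Finset.sum_congr rfl fun j _ => ?_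
      rw [hsymm i j, real_inner_comm, mul_assoc]
  rw [h2]
  field_simp
  rw [sq, hsq]

/-- If the mean curvature vanishes, then the weighted dual frame of a coordinate frame is
divergence-free, that is, the coordinate functions are harmonic. -/
theorem hasFDerivAt_fluxFrame_of_minimal [FiniteDimensional ℝ V] {e : E → ι → V}
    {e' : ι → E →L[ℝ] V} {x : E}
    (he : ∀ i, HasFDerivAt (fun y => e y i) (e' i) x) (hdet : 0 < (Matrix.gram ℝ (e x)).det)
    {a : ι → E} (hsymm : ∀ i j, e' i (a j) = e' j (a i))
    (hmin : ∑ i, ∑ j, (Matrix.gram ℝ (e x))⁻¹ i j •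
      (Submodule.span ℝ (range (e x)))ᗮ.starProjection (e' j (a i)) = 0) :
    ∃ Y' : ι → E →L[ℝ] V, (∀ i, HasFDerivAt (fun y => fluxFrame (e y) i) (Y' i) x) ∧
      ∑ i, Y' i (a i) = 0 := by
  obtain ⟨s', hs', hs'w⟩ := hasFDerivAt_sqrt_det_gram he hdet
  have hg : ∀ i j, DifferentiableAt ℝ (fun y => Matrix.gram ℝ (e y) i j) x := fun i j =>
    (he i).differentiableAt.inner ℝ (he j).differentiableAt
  have hdetA := hasFDerivAt_det fun i j => (hg i j).hasFDerivAt
  have hinv : ∀ i j, DifferentiableAt ℝ (fun y => (Matrix.gram ℝ (e y))⁻¹ i j) x := by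
    intro i j
    have h : (fun y => (Matrix.gram ℝ (e y))⁻¹ i j) = fun y =>
        (Matrix.gram ℝ (e y)).det⁻¹ * (Matrix.gram ℝ (e y)).adjugate i j := by
      funext y
      simp [Matrix.inv_def]
    rw [h]
    refine (hdetA.differentiableAt.inv hdet.ne').mul ?_
    simp only [Matrix.adjugate_apply]
    refine (hasFDerivAt_det (A' := fun k l => fderiv ℝ (fun y =>
      (Matrix.gram ℝ (e y)).updateRow j (Pi.single i 1) k l) x) fun k l => ?_).differentiableAt
    refine DifferentiableAt.hasFDerivAt ?_
    simp only [Matrix.updateRow_apply]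
    split_ifs
    · exact differentiableAt_const _
    · exact hg k l
  set W : ι → ι → E → ℝ := fun i j y =>
    √(Matrix.gram ℝ (e y)).det * (Matrix.gram ℝ (e y))⁻¹ i j with hW
  have hWd : ∀ i j, HasFDerivAt (W i j) (fderiv ℝ (W i j) x) x := fun i j =>
    (hs'.differentiableAt.mul (hinv i j)).hasFDerivAt
  set Y' : ι → E →L[ℝ] V := fun i =>
    ∑ j, (W i j x • e' j + (fderiv ℝ (W i j) x).smulRight (e x j)) with hY'
  have hY : ∀ i, HasFDerivAt (fun y => fluxFrame (e y) i) (Y' i) x := by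
    intro i
    have h : (fun y => fluxFrame (e y) i) = fun y => ∑ j, W i j y • e y j := by
      funext y
      simp [fluxFrame, dualFrame, Finset.smul_sum, smul_smul, hW]
    rw [h]
    exact HasFDerivAt.fun_sum fun j _ => (hWd i j).smul (he j)
  refine ⟨Y', hY, ?_⟩
  set S : V := ∑ i, Y' i (a i) with hS
  -- The tangential part vanishes because `⟨√g eⁱ, eₖ⟩ = √g δⁱₖ` near `x`.
  have htan : ∀ k, inner ℝ S (e x k) = 0 := by
    intro k
    have hev : ∀ᶠ y in 𝓝 x, 0 < (Matrix.gram ℝ (e y)).det :=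
      hdetA.continuousAt.eventually (lt_mem_nhds hdet)
    have h1 : ∀ i w, inner ℝ (fluxFrame (e x) i) (e' k w) + inner ℝ (Y' i w) (e x k) =
        if i = k then s' w else 0 := by
      intro i w
      have h2 : HasFDerivAt (fun y => (if i = k then √(Matrix.gram ℝ (e y)).det else 0 : ℝ))
          (if i = k then s' else 0) x := by
        split_ifs
        · exact hs'
        · exact hasFDerivAt_const _ _
      have h3 := ((hY i).inner ℝ (he k)).congr_of_eventuallyEq
        (f₁ := fun y => (if i = k then √(Matrix.gram ℝ (e y)).det else 0 : ℝ)) (by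
          filter_upwards [hev] with y hy
          rw [fluxFrame, real_inner_smul_left, inner_dualFrame hy.ne']
          split_ifs <;> simp)
      have h4 := congrArg (fun T : E →L[ℝ] ℝ => T w) (h3.unique h2)
      simp only [ContinuousLinearMap.comp_apply, ContinuousLinearMap.prod_apply,
        fderivInnerCLM_apply] at h4
      rw [h4]
      split_ifs <;> rfl
    have h5 : ∑ i, (inner ℝ (fluxFrame (e x) i) (e' k (a i)) + inner ℝ (Y' i (a i)) (e x k)) =
        s' (a k) := by
      simp [h1]
    rw [Finset.sum_add_distrib, hs'w] at h5
    simp only [hsymm _ k] at h5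
    rw [hS, sum_inner]
    linarith
  -- The normal part vanishes because the mean curvature does.
  have hnor : inner ℝ S S = 0 := by
    have hSmem : S ∈ (Submodule.span ℝ (range (e x)))ᗮ := by
      rw [Submodule.mem_orthogonal']
      exact fun w hw => inner_eq_zero_of_mem_span htan hw
    have h6 : ∀ z, inner ℝ z S =
        inner ℝ ((Submodule.span ℝ (range (e x)))ᗮ.starProjection z) S := fun z => by
      rw [Submodule.inner_starProjection_left_eq_right,
        Submodule.starProjection_eq_self_iff.2 hSmem]
    have h7 := congrArg (fun z => √(Matrix.gram ℝ (e x)).det * inner ℝ z S) hmin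
    simp only [sum_inner, real_inner_smul_left, ← h6, inner_zero_left, mul_zero,
      Finset.mul_sum] at h7
    conv_lhs => arg 2; rw [hS]
    simp only [hY', sum_inner, sum_apply, add_apply, smul_apply,
      ContinuousLinearMap.smulRight_apply, inner_add_left, real_inner_smul_left,
      real_inner_comm S (e x _), htan, mul_zero, add_zero, hW]
    simpa only [mul_assoc] using h7
  exact inner_self_eq_zero.1 hnor

end Minimal

/-! ### The divergence theorem in the half-space -/

section HalfSpace

variable {m : ℕ}

/-- A function on a relatively open subset `T` of a closed set `H`, continuous and vanishing off a
compact subset of `T`, extends by zero to a continuous function on `H`. -/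
theorem continuousOn_indicator_of_compact {X : Type*} [TopologicalSpace X] [T2Space X] {Y : Type*}
    [TopologicalSpace Y] [Zero Y] {T O H K : Set X} (hO : IsOpen O) (hT : T = O ∩ H)
    (hK : IsCompact K) (hKT : K ⊆ T) {g : X → Y} (hg : ContinuousOn g T)
    (h0 : ∀ x ∈ T, x ∉ K → g x = 0) : ContinuousOn (T.indicator g) H := by
  intro x hx
  by_cases hxT : x ∈ T
  · have hTn : T ∈ 𝓝[H] x := by
      rw [hT, inter_comm]
      exact inter_mem_nhdsWithin _ (hO.mem_nhds (hT ▸ hxT).1)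
    have h1 : ContinuousWithinAt g H x := (hg x hxT).mono_of_mem_nhdsWithin hTn
    refine h1.congr_of_eventuallyEq ?_ (indicator_of_mem hxT g)
    filter_upwards [hTn] with y hy using indicator_of_mem hy g
  · have hxK : x ∉ K := fun h => hxT (hKT h)
    have h1 : T.indicator g =ᶠ[𝓝 x] fun _ => 0 := by
      filter_upwards [hK.isClosed.isOpen_compl.mem_nhds hxK] with y hy
      by_cases hyT : y ∈ T
      · rw [indicator_of_mem hyT, h0 y hyT hy]
      · exact indicator_of_notMem hyT g
    exact (continuousAt_const.congr h1.symm).continuousWithinAt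

/-- The divergence theorem for a compactly supported vector field on a relatively open subset of
the half-space. -/
theorem integral_divergence_halfSpace {T O K : Set (EuclideanSpace ℝ (Fin (m + 1)))}
    (hO : IsOpen O) (hT : T = O ∩ {x | 0 ≤ x 0}) (hK : IsCompact K) (hKT : K ⊆ T)
    {W : Fin (m + 1) → EuclideanSpace ℝ (Fin (m + 1)) → ℝ}
    {D : EuclideanSpace ℝ (Fin (m + 1)) → ℝ}
    (hWc : ∀ i, ContinuousOn (W i) T) (hDc : ContinuousOn D T)
    (hW0 : ∀ i, ∀ x ∈ T, x ∉ K → W i x = 0) (hD0 : ∀ x ∈ T, x ∉ K → D x = 0)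
    (hW' : ∀ x ∈ T, 0 < x 0 → ∃ W' : Fin (m + 1) → EuclideanSpace ℝ (Fin (m + 1)) →L[ℝ] ℝ,
      (∀ i, HasFDerivAt (W i) (W' i) x) ∧ ∑ i, W' i (EuclideanSpace.single i 1) = D x) :
    ∫ x in T, D x = -∫ y in toBoundary m ⁻¹' T, W 0 (toBoundary m y) := by
  set H : Set (EuclideanSpace ℝ (Fin (m + 1))) := {x | 0 ≤ x 0} with hH
  have hHclosed : IsClosed H := isClosed_le continuous_const (by fun_prop)
  have hTm : MeasurableSet T := hT ▸ hO.measurableSet.inter hHclosed.measurableSet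
  have hWt : ∀ i, ContinuousOn (T.indicator (W i)) H := fun i =>
    continuousOn_indicator_of_compact hO hT hK hKT (hWc i) (hW0 i)
  have hDt : ContinuousOn (T.indicator D) H :=
    continuousOn_indicator_of_compact hO hT hK hKT hDc hD0
  have hzero : ∀ {g : EuclideanSpace ℝ (Fin (m + 1)) → ℝ}, (∀ x ∈ T, x ∉ K → g x = 0) →
      ∀ x, x ∉ K → T.indicator g x = 0 := by
    intro g hg x hx
    by_cases hxT : x ∈ T
    · rw [indicator_of_mem hxT, hg x hxT hx]
    · exact indicator_of_notMem hxT g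
  -- On the face `x 0 = 0` nothing is differentiated: there the values are only chosen so that their
  -- trace is `D`, which makes the integrand of the box theorem equal to `D` everywhere.
  have hder : ∀ x, ∃ W' : Fin (m + 1) → EuclideanSpace ℝ (Fin (m + 1)) →L[ℝ] ℝ,
      (0 < x 0 → ∀ i, HasFDerivAt (T.indicator (W i)) (W' i) x) ∧
        ∑ i, W' i (EuclideanSpace.single i 1) = T.indicator D x := by
    intro x
    by_cases hx0 : 0 < x 0
    · by_cases hxT : x ∈ T
      · obtain ⟨W', h1, h2⟩ := hW' x hxT hx0
        refine ⟨W', fun _ i => (h1 i).congr_of_eventuallyEq ?_, by rw [h2, indicator_of_mem hxT]⟩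
        have hpos : IsOpen {x : EuclideanSpace ℝ (Fin (m + 1)) | 0 < x 0} :=
          isOpen_lt continuous_const (by fun_prop)
        filter_upwards [hO.mem_nhds (hT ▸ hxT).1, hpos.mem_nhds hx0] with y hy hy0
        exact indicator_of_mem (by rw [hT]; exact ⟨hy, hy0.le⟩) _
      · have hxK : x ∉ K := fun h => hxT (hKT h)
        refine ⟨0, fun _ i => ?_, by simp [hxT]⟩
        refine (hasFDerivAt_const (0 : ℝ) x).congr_of_eventuallyEq ?_
        filter_upwards [hK.isClosed.isOpen_compl.mem_nhds hxK] with y hy using hzero (hW0 i) y hy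
    · refine ⟨fun i => if i = 0 then T.indicator D x • EuclideanSpace.proj 0 else 0,
        fun h => absurd h hx0, ?_⟩
      rw [Finset.sum_eq_single 0]
      · simp
      · intro i _ hi
        simp [hi]
      · simp
  choose W' hW'd hW's using hder
  obtain ⟨R, hR0, hR⟩ := hK.isBounded.exists_pos_norm_lt
  have hRi : ∀ x ∈ K, ∀ i, |x i| < R := fun x hx i =>
    (by simpa using PiLp.norm_apply_le x i : |x i| ≤ ‖x‖).trans_lt (hR x hx)
  let J : (Fin (m + 1) → ℝ) ≃L[ℝ] EuclideanSpace ℝ (Fin (m + 1)) :=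
    (PiLp.continuousLinearEquiv 2 ℝ (fun _ : Fin (m + 1) => ℝ)).symm
  have hJ : ∀ z i, J z i = z i := fun z i => rfl
  let a : Fin (m + 1) → ℝ := Fin.cons 0 fun _ => -R
  let b : Fin (m + 1) → ℝ := fun _ => R
  have hab : a ≤ b := by
    intro i
    refine Fin.cases ?_ (fun j => ?_) i
    · exact hR0.le
    · simp only [a, b, Fin.cons_succ]; linarith
  have hmaps : MapsTo J (Icc a b) H := fun z hz => by
    have := hz.1 0
    simpa [a, hH, hJ] using this
  have hdiv := integral_divergence_of_hasFDerivAt_off_countable' a b hab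
    (fun i z => T.indicator (W i) (J z)) (fun i z => (W' (J z) i).comp J.toContinuousLinearMap) ∅
    countable_empty (fun i => (hWt i).comp J.continuous.continuousOn hmaps)
    (fun z hz i => by
      refine HasFDerivAt.comp z (hW'd (J z) ?_ i) J.hasFDerivAt
      have := (hz.1 0 (mem_univ _)).1
      simpa [a, hJ] using this)
  have hsum : ∀ z, ∑ i, ((W' (J z) i).comp J.toContinuousLinearMap) (Pi.single i 1) =
      T.indicator D (J z) := fun z => by
    rw [← hW's (J z)]
    rfl
  simp only [hsum] at hdiv
  specialize hdiv ((hDt.comp J.continuous.continuousOn hmaps).integrableOn_compact isCompact_Icc)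
  have hL : ∫ x in T, D x = ∫ z in Icc a b, T.indicator D (J z) := by
    rw [← integral_indicator hTm, ← (PiLp.volume_preserving_toLp (Fin (m + 1))).integral_comp
      (MeasurableEquiv.toLp 2 _).measurableEmbedding]
    refine (setIntegral_eq_integral_of_forall_compl_eq_zero fun z hz => ?_).symm
    by_contra hne
    have hzK : J z ∈ K := by
      by_contra h
      exact hne (hzero hD0 _ h)
    refine hz ⟨fun i => ?_, fun i => (abs_lt.1 (hRi _ hzK i)).2.le⟩
    refine Fin.cases ?_ (fun j => ?_) i
    · have := hKT hzK
      rw [hT] at this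
      exact this.2
    · exact (abs_lt.1 (hRi _ hzK j.succ)).1.le
  -- The field vanishes on all faces of the box but `x 0 = 0`, as `K` lies in the open ball.
  have hface : ∀ (i : Fin (m + 1)) (c : ℝ), |c| = R → ∀ y : Fin m → ℝ,
      T.indicator (W i) (J (i.insertNth c y)) = 0 := by
    intro i c hc y
    refine hzero (hW0 i) _ fun h => ?_
    have := hRi _ h i
    rw [hJ, Fin.insertNth_apply_same, hc] at this
    exact lt_irrefl _ this
  rw [hL, hdiv, Fin.sum_univ_succ]
  have hRabs : |R| = R := abs_of_pos hR0
  simp only [a, b, Fin.cons_zero, Fin.cons_succ, hface _ _ hRabs,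
    hface _ (-R) (by rw [abs_neg, hRabs]), integral_zero, sub_zero, Finset.sum_const_zero,
    add_zero, zero_sub, neg_inj]
  have hBm : MeasurableSet (toBoundary m ⁻¹' T) := by
    have : Continuous (toBoundary m) := by
      unfold toBoundary
      refine (PiLp.continuous_toLp 2 _).comp ?_
      refine continuous_pi fun i => ?_
      refine Fin.cases ?_ (fun j => ?_) i
      · simpa using continuous_const
      · simp only [Fin.cons_succ]; fun_prop
    exact this.measurable hTm
  rw [← integral_indicator hBm, ← (PiLp.volume_preserving_toLp (Fin m)).integral_comp
      (MeasurableEquiv.toLp 2 _).measurableEmbedding]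
  have hpt : ∀ y : Fin m → ℝ, (toBoundary m ⁻¹' T).indicator (fun y => W 0 (toBoundary m y))
      (WithLp.toLp 2 y) = T.indicator (W 0) (J (Fin.insertNth 0 0 y)) := by
    intro y
    rw [Fin.insertNth_zero']
    rfl
  simp only [hpt]
  refine setIntegral_eq_integral_of_forall_compl_eq_zero fun z hz => ?_
  refine hzero (hW0 0) _ fun h => hz ⟨fun j => ?_, fun j => ?_⟩
  all_goals
    have h3 := abs_lt.1 (hRi _ h j.succ)
    rw [hJ, Fin.insertNth_zero', Fin.cons_succ] at h3
  · simpa using h3.1.le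
  · simpa using h3.2.le

end HalfSpace

/-! ### Calculus in the charts -/

section Charts

variable {m n : ℕ} {M : Type*} [TopologicalSpace M] [ChartedSpace (EuclideanHalfSpace (m + 1)) M]

theorem exists_isOpen_chart_target (c : M) : ∃ O : Set (EuclideanSpace ℝ (Fin (m + 1))), IsOpen O ∧
    (extChartAt (𝓡∂ (m + 1)) c).target = O ∩ {x | 0 ≤ x 0} := by
  refine ⟨(𝓡∂ (m + 1)).symm ⁻¹' (chartAt (EuclideanHalfSpace (m + 1)) c).target,
    (chartAt _ c).open_target.preimage (𝓡∂ (m + 1)).continuous_symm, ?_⟩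
  rw [extChartAt_target, range_modelWithCornersEuclideanHalfSpace]

theorem measurableSet_chart_target (c : M) :
    MeasurableSet (extChartAt (𝓡∂ (m + 1)) c).target := by
  obtain ⟨O, hO, h⟩ := exists_isOpen_chart_target (m := m) c
  rw [h]
  exact hO.measurableSet.inter (isClosed_le continuous_const (by fun_prop)).measurableSet

theorem chart_target_mem_nhds {c : M} {x : EuclideanSpace ℝ (Fin (m + 1))}
    (hx : x ∈ (extChartAt (𝓡∂ (m + 1)) c).target) (h0 : 0 < x 0) :
    (extChartAt (𝓡∂ (m + 1)) c).target ∈ 𝓝 x := by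
  obtain ⟨O, hO, h⟩ := exists_isOpen_chart_target (m := m) c
  have hpos : IsOpen {x : EuclideanSpace ℝ (Fin (m + 1)) | 0 < x 0} :=
    isOpen_lt continuous_const (by fun_prop)
  filter_upwards [hO.mem_nhds (h ▸ hx).1, hpos.mem_nhds h0] with y hy hy0
  exact h ▸ ⟨hy, hy0.le⟩

/-- The derivative, in the chart centred at `c`, of a map on `M`, taken within the half-space. -/
def chartDeriv {G : Type*} [NormedAddCommGroup G] [NormedSpace ℝ G] (c : M) (g : M → G)
    (x : EuclideanSpace ℝ (Fin (m + 1))) : EuclideanSpace ℝ (Fin (m + 1)) →L[ℝ] G :=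
  fderivWithin ℝ (g ∘ (extChartAt (𝓡∂ (m + 1)) c).symm) (range (𝓡∂ (m + 1))) x

theorem chartDeriv_single (c : M) (u : M → EuclideanSpace ℝ (Fin n))
    (x : EuclideanSpace ℝ (Fin (m + 1))) (i : Fin (m + 1)) :
    chartDeriv c u x (EuclideanSpace.single i 1) = coordVec c u x i := rfl

theorem uniqueDiffWithinAt_chart {c : M} {x : EuclideanSpace ℝ (Fin (m + 1))}
    (hx : x ∈ (extChartAt (𝓡∂ (m + 1)) c).target) :
    UniqueDiffWithinAt ℝ (range (𝓡∂ (m + 1))) x :=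
  (𝓡∂ (m + 1)).uniqueDiffOn x (extChartAt_target_subset_range c hx)

variable [IsManifold (𝓡∂ (m + 1)) ∞ M]

section Generic

variable {G : Type*} [NormedAddCommGroup G] [NormedSpace ℝ G] {g : M → G}

theorem contDiffOn_comp_chart_symm (hg : ContMDiff (𝓡∂ (m + 1)) 𝓘(ℝ, G) ∞ g) (c : M) :
    ContDiffOn ℝ ∞ (g ∘ (extChartAt (𝓡∂ (m + 1)) c).symm) (extChartAt (𝓡∂ (m + 1)) c).target :=
  contMDiffOn_iff_contDiffOn.1 (hg.comp_contMDiffOn (contMDiffOn_extChartAt_symm c))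

theorem hasFDerivWithinAt_chartDeriv (hg : ContMDiff (𝓡∂ (m + 1)) 𝓘(ℝ, G) ∞ g) {c : M}
    {x : EuclideanSpace ℝ (Fin (m + 1))} (hx : x ∈ (extChartAt (𝓡∂ (m + 1)) c).target) :
    HasFDerivWithinAt (g ∘ (extChartAt (𝓡∂ (m + 1)) c).symm) (chartDeriv c g x)
      (range (𝓡∂ (m + 1))) x :=
  (((contDiffOn_comp_chart_symm hg c x hx).differentiableWithinAt
    (by simp)).mono_of_mem_nhdsWithin
      (extChartAt_target_mem_nhdsWithin_of_mem hx)).hasFDerivWithinAt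

theorem hasFDerivAt_chartDeriv (hg : ContMDiff (𝓡∂ (m + 1)) 𝓘(ℝ, G) ∞ g) {c : M}
    {x : EuclideanSpace ℝ (Fin (m + 1))} (hx : x ∈ (extChartAt (𝓡∂ (m + 1)) c).target)
    (h0 : 0 < x 0) :
    HasFDerivAt (g ∘ (extChartAt (𝓡∂ (m + 1)) c).symm) (chartDeriv c g x) x :=
  (hasFDerivWithinAt_chartDeriv hg hx).hasFDerivAt
    (mem_of_superset (chart_target_mem_nhds hx h0) (extChartAt_target_subset_range c))

theorem contDiffOn_chartDeriv (hg : ContMDiff (𝓡∂ (m + 1)) 𝓘(ℝ, G) ∞ g) (c : M) :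
    ContDiffOn ℝ ∞ (chartDeriv c g) (extChartAt (𝓡∂ (m + 1)) c).target := by
  refine ((contDiffOn_comp_chart_symm hg c).fderivWithin (m := ∞)
    (uniqueDiffOn_extChartAt_target c) (by simp)).congr fun x hx => ?_
  exact ((hasFDerivWithinAt_chartDeriv hg hx).mono
    (extChartAt_target_subset_range c)).fderivWithin (uniqueDiffOn_extChartAt_target c x hx) |>.symm

/-- The chain rule for the derivative in a chart. -/
theorem chartDeriv_eq_mfderiv (hg : ContMDiff (𝓡∂ (m + 1)) 𝓘(ℝ, G) ∞ g) {c : M}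
    {x : EuclideanSpace ℝ (Fin (m + 1))} (hx : x ∈ (extChartAt (𝓡∂ (m + 1)) c).target)
    (w : EuclideanSpace ℝ (Fin (m + 1))) :
    chartDeriv c g x w =
      mfderiv (𝓡∂ (m + 1)) 𝓘(ℝ, G) g ((extChartAt (𝓡∂ (m + 1)) c).symm x)
        (mfderivWithin 𝓘(ℝ, EuclideanSpace ℝ (Fin (m + 1))) (𝓡∂ (m + 1))
          (extChartAt (𝓡∂ (m + 1)) c).symm (range (𝓡∂ (m + 1))) x w) := by
  have : IsManifold (𝓡∂ (m + 1)) 1 M := IsManifold.of_le (n := ∞) (by simp)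
  have h1 := mfderiv_comp_mfderivWithin x
    (I := 𝓘(ℝ, EuclideanSpace ℝ (Fin (m + 1)))) (I' := 𝓡∂ (m + 1)) (I'' := 𝓘(ℝ, G))
    (s := range (𝓡∂ (m + 1))) (f := (extChartAt (𝓡∂ (m + 1)) c).symm) (g := g)
    (hg.mdifferentiable (by simp) _) (mdifferentiableWithinAt_extChartAt_symm hx)
    (uniqueDiffWithinAt_chart hx).uniqueMDiffWithinAt
  rw [mfderivWithin_eq_fderivWithin] at h1
  exact congrArg (fun T => T w) h1

end Generic

theorem bijective_mfderivWithin_chart_symm {c : M}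
    {x : EuclideanSpace ℝ (Fin (m + 1))} (hx : x ∈ (extChartAt (𝓡∂ (m + 1)) c).target) :
    Function.Bijective (mfderivWithin 𝓘(ℝ, EuclideanSpace ℝ (Fin (m + 1))) (𝓡∂ (m + 1))
          (extChartAt (𝓡∂ (m + 1)) c).symm (range (𝓡∂ (m + 1))) x) := by
  have : IsManifold (𝓡∂ (m + 1)) 1 M := IsManifold.of_le (n := ∞) (by simp)
  exact (isInvertible_mfderivWithin_extChartAt_symm hx).bijective

variable {u : M → EuclideanSpace ℝ (Fin n)}

theorem span_coordVec (hu : ContMDiff (𝓡∂ (m + 1)) 𝓘(ℝ, EuclideanSpace ℝ (Fin n)) ∞ u) {c : M}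
    {x : EuclideanSpace ℝ (Fin (m + 1))} (hx : x ∈ (extChartAt (𝓡∂ (m + 1)) c).target) :
    Submodule.span ℝ (range (coordVec c u x)) =
      tangentPlane m u ((extChartAt (𝓡∂ (m + 1)) c).symm x) := by
  have h1 : Submodule.span ℝ (range (coordVec c u x)) = (chartDeriv c u x).range := by
    rw [LinearMap.range_eq_map, ← (EuclideanSpace.basisFun (Fin (m + 1)) ℝ).toBasis.span_eq,
      Submodule.map_span, ← range_comp]
    congr 2
    funext i
    simp [chartDeriv_single]
  rw [h1]
  apply le_antisymm
  · rintro _ ⟨w, rfl⟩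
    exact ⟨_, (chartDeriv_eq_mfderiv hu hx w).symm⟩
  · rintro _ ⟨w, rfl⟩
    obtain ⟨z, rfl⟩ := (bijective_mfderivWithin_chart_symm hx).2 w
    exact ⟨z, chartDeriv_eq_mfderiv hu hx z⟩

end Charts

/-! ### Coordinate frames of an immersion -/

section Charts

variable {m n : ℕ} {M : Type*} [TopologicalSpace M] [ChartedSpace (EuclideanHalfSpace (m + 1)) M]

/-- The tangent vector of `M` at `p` whose image in `ℝⁿ` is the tangential part of `X`. -/
def tangentLift (u : M → EuclideanSpace ℝ (Fin n)) (p : M) (X : EuclideanSpace ℝ (Fin n)) :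
    TangentSpace (𝓡∂ (m + 1)) p :=
  Function.invFun (mfderiv (𝓡∂ (m + 1)) 𝓘(ℝ, EuclideanSpace ℝ (Fin n)) u p)
    ((tangentPlane m u p).starProjection X)

/-- The derivative of `g` along the tangential part of the vector field `X`. -/
def tangentialDeriv (m : ℕ) {n : ℕ} {M : Type*} [TopologicalSpace M]
    [ChartedSpace (EuclideanHalfSpace (m + 1)) M] (u X : M → EuclideanSpace ℝ (Fin n)) (g : M → ℝ)
    (p : M) : ℝ :=
  mfderiv (𝓡∂ (m + 1)) 𝓘(ℝ, ℝ) g p (tangentLift (m := m) u p (X p))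

theorem mfderiv_tangentLift (u : M → EuclideanSpace ℝ (Fin n)) (p : M)
    (X : EuclideanSpace ℝ (Fin n)) :
    mfderiv (𝓡∂ (m + 1)) 𝓘(ℝ, EuclideanSpace ℝ (Fin n)) u p (tangentLift (m := m) u p X) =
      (tangentPlane m u p).starProjection X :=
  Function.invFun_eq (Submodule.starProjection_apply_mem (tangentPlane m u p) X)

theorem mfderiv_eq_zero_of_notMem_tsupport {g : M → ℝ} {p : M} (hp : p ∉ tsupport g) :
    mfderiv (𝓡∂ (m + 1)) 𝓘(ℝ, ℝ) g p = 0 := by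
  rw [(notMem_tsupport_iff_eventuallyEq.1 hp).mfderiv_eq]
  exact mfderiv_const

variable [IsManifold (𝓡∂ (m + 1)) ∞ M] {u : M → EuclideanSpace ℝ (Fin n)}

theorem linearIndependent_coordVec
    (hu : ContMDiff (𝓡∂ (m + 1)) 𝓘(ℝ, EuclideanSpace ℝ (Fin n)) ∞ u)
    (hi : ∀ p, Function.Injective (mfderiv (𝓡∂ (m + 1)) 𝓘(ℝ, EuclideanSpace ℝ (Fin n)) u p))
    {c : M} {x : EuclideanSpace ℝ (Fin (m + 1))}
    (hx : x ∈ (extChartAt (𝓡∂ (m + 1)) c).target) : LinearIndependent ℝ (coordVec c u x) := by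
  have hinj : Function.Injective (chartDeriv c u x) := by
    intro a b hab
    rw [chartDeriv_eq_mfderiv hu hx, chartDeriv_eq_mfderiv hu hx] at hab
    exact (bijective_mfderivWithin_chart_symm hx).1 (hi _ hab)
  have h := (EuclideanSpace.basisFun (Fin (m + 1)) ℝ).toBasis.linearIndependent.map'
    (chartDeriv c u x).toLinearMap (LinearMap.ker_eq_bot.2 hinj)
  have he : coordVec c u x = (chartDeriv c u x).toLinearMap ∘
      (EuclideanSpace.basisFun (Fin (m + 1)) ℝ).toBasis := by
    funext i
    simp [chartDeriv_single]
  rw [he]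
  exact h

theorem det_gram_coordVec_pos
    (hu : ContMDiff (𝓡∂ (m + 1)) 𝓘(ℝ, EuclideanSpace ℝ (Fin n)) ∞ u)
    (hi : ∀ p, Function.Injective (mfderiv (𝓡∂ (m + 1)) 𝓘(ℝ, EuclideanSpace ℝ (Fin n)) u p))
    {c : M} {x : EuclideanSpace ℝ (Fin (m + 1))}
    (hx : x ∈ (extChartAt (𝓡∂ (m + 1)) c).target) :
    0 < (Matrix.gram ℝ (coordVec c u x)).det :=
  det_gram_pos (linearIndependent_coordVec hu hi hx)

theorem contDiffOn_coordVec
    (hu : ContMDiff (𝓡∂ (m + 1)) 𝓘(ℝ, EuclideanSpace ℝ (Fin n)) ∞ u) (c : M) (i : Fin (m + 1)) :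
    ContDiffOn ℝ ∞ (fun x => coordVec c u x i) (extChartAt (𝓡∂ (m + 1)) c).target :=
  (contDiffOn_chartDeriv hu c).clm_apply contDiffOn_const

theorem contDiffOn_sqrt_det_gram
    (hu : ContMDiff (𝓡∂ (m + 1)) 𝓘(ℝ, EuclideanSpace ℝ (Fin n)) ∞ u)
    (hi : ∀ p, Function.Injective (mfderiv (𝓡∂ (m + 1)) 𝓘(ℝ, EuclideanSpace ℝ (Fin n)) u p))
    (c : M) :
    ContDiffOn ℝ ∞ (fun x => √(Matrix.gram ℝ (coordVec c u x)).det)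
      (extChartAt (𝓡∂ (m + 1)) c).target := fun x hx =>
  (ContDiffWithinAt.matrix_det fun i j =>
    (contDiffOn_coordVec hu c i x hx).inner ℝ (contDiffOn_coordVec hu c j x hx)).sqrt
      (det_gram_coordVec_pos hu hi hx).ne'

theorem contDiffOn_dualFrame
    (hu : ContMDiff (𝓡∂ (m + 1)) 𝓘(ℝ, EuclideanSpace ℝ (Fin n)) ∞ u)
    (hi : ∀ p, Function.Injective (mfderiv (𝓡∂ (m + 1)) 𝓘(ℝ, EuclideanSpace ℝ (Fin n)) u p))
    (c : M) (i : Fin (m + 1)) :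
    ContDiffOn ℝ ∞ (fun x => dualFrame (coordVec c u x) i)
      (extChartAt (𝓡∂ (m + 1)) c).target := fun x hx =>
  ContDiffWithinAt.sum fun j _ => (ContDiffWithinAt.matrix_inv (fun i j =>
    (contDiffOn_coordVec hu c i x hx).inner ℝ (contDiffOn_coordVec hu c j x hx))
      (det_gram_coordVec_pos hu hi hx).ne' i j).smul (contDiffOn_coordVec hu c j x hx)

/-- The derivative along the tangential part of a vector field, in a chart. -/
theorem tangentialDeriv_chart
    (hu : ContMDiff (𝓡∂ (m + 1)) 𝓘(ℝ, EuclideanSpace ℝ (Fin n)) ∞ u)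
    (hi : ∀ p, Function.Injective (mfderiv (𝓡∂ (m + 1)) 𝓘(ℝ, EuclideanSpace ℝ (Fin n)) u p))
    {g : M → ℝ} (hg : ContMDiff (𝓡∂ (m + 1)) 𝓘(ℝ, ℝ) ∞ g) (X : M → EuclideanSpace ℝ (Fin n))
    {c : M} {x : EuclideanSpace ℝ (Fin (m + 1))}
    (hx : x ∈ (extChartAt (𝓡∂ (m + 1)) c).target) :
    tangentialDeriv m u X g ((extChartAt (𝓡∂ (m + 1)) c).symm x) =
      ∑ i, inner ℝ (X ((extChartAt (𝓡∂ (m + 1)) c).symm x)) (dualFrame (coordVec c u x) i) *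
        chartDeriv c g x (EuclideanSpace.single i 1) := by
  set p := (extChartAt (𝓡∂ (m + 1)) c).symm x with hp
  set w : EuclideanSpace ℝ (Fin (m + 1)) :=
    ∑ i, (inner ℝ (X p) (dualFrame (coordVec c u x) i) : ℝ) • EuclideanSpace.single i 1 with hw
  have h1 : chartDeriv c u x w = (tangentPlane m u p).starProjection (X p) := by
    simp only [hp, ← span_coordVec hu hx]
    rw [← sum_inner_dualFrame_smul (det_gram_coordVec_pos hu hi hx).ne', hw, map_sum]
    simp only [map_smul, chartDeriv_single, hp]
  have h2 : tangentLift (m := m) u p (X p) =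
      mfderivWithin 𝓘(ℝ, EuclideanSpace ℝ (Fin (m + 1))) (𝓡∂ (m + 1))
          (extChartAt (𝓡∂ (m + 1)) c).symm (range (𝓡∂ (m + 1))) x w := by
    apply hi p
    rw [mfderiv_tangentLift, ← h1, chartDeriv_eq_mfderiv hu hx]
  rw [tangentialDeriv, h2]
  refine (chartDeriv_eq_mfderiv hg hx w).symm.trans ?_
  rw [hw, map_sum]
  simp only [map_smul, smul_eq_mul]

theorem chartDeriv_eq_zero_of_notMem_tsupport
    {g : M → ℝ} (hg : ContMDiff (𝓡∂ (m + 1)) 𝓘(ℝ, ℝ) ∞ g) {c : M}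
    {x : EuclideanSpace ℝ (Fin (m + 1))} (hx : x ∈ (extChartAt (𝓡∂ (m + 1)) c).target)
    (hp : (extChartAt (𝓡∂ (m + 1)) c).symm x ∉ tsupport g) (w : EuclideanSpace ℝ (Fin (m + 1))) :
    chartDeriv c g x w = 0 := by
  rw [chartDeriv_eq_mfderiv hg hx, mfderiv_eq_zero_of_notMem_tsupport hp]
  rfl

/-- In the interior of a chart of a minimal submanifold, the weighted dual coordinate frame is
divergence-free. -/
theorem hasFDerivAt_fluxFrame_coordVec
    (hu : ContMDiff (𝓡∂ (m + 1)) 𝓘(ℝ, EuclideanSpace ℝ (Fin n)) ∞ u)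
    (hi : ∀ p, Function.Injective (mfderiv (𝓡∂ (m + 1)) 𝓘(ℝ, EuclideanSpace ℝ (Fin n)) u p))
    {c : M} {x : EuclideanSpace ℝ (Fin (m + 1))}
    (hx : x ∈ (extChartAt (𝓡∂ (m + 1)) c).target) (h0 : 0 < x 0)
    (hmin : meanCurvature c u x = 0) :
    ∃ Y' : Fin (m + 1) → EuclideanSpace ℝ (Fin (m + 1)) →L[ℝ] EuclideanSpace ℝ (Fin n),
      (∀ i, HasFDerivAt (fun y => fluxFrame (coordVec c u y) i) (Y' i) x) ∧
        ∑ i, Y' i (EuclideanSpace.single i 1) = 0 := by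
  have hxn := chart_target_mem_nhds hx h0
  have hR : range (𝓡∂ (m + 1)) ∈ 𝓝 x := mem_of_superset hxn (extChartAt_target_subset_range c)
  have hL : HasFDerivAt (chartDeriv c u) (fderivWithin ℝ (chartDeriv c u) (range (𝓡∂ (m + 1))) x)
      x := by
    have h1 : DifferentiableAt ℝ (chartDeriv c u) x :=
      (((contDiffOn_chartDeriv hu c).contDiffAt hxn).differentiableAt (by simp))
    rw [fderivWithin_of_mem_nhds hR]
    exact h1.hasFDerivAt
  set L' := fderivWithin ℝ (chartDeriv c u) (range (𝓡∂ (m + 1))) x with hL'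
  have hsymm : ∀ a b, L' a b = L' b a := by
    intro a b
    refine second_derivative_symmetric_of_eventually (𝕜 := ℝ)
      (f := u ∘ (extChartAt (𝓡∂ (m + 1)) c).symm) (f' := chartDeriv c u) ?_ hL a b
    have hpos : IsOpen {x : EuclideanSpace ℝ (Fin (m + 1)) | 0 < x 0} :=
      isOpen_lt continuous_const (by fun_prop)
    filter_upwards [hxn, hpos.mem_nhds h0] with y hy hy0 using hasFDerivAt_chartDeriv hu hy hy0
  refine hasFDerivAt_fluxFrame_of_minimal (e := coordVec c u)
    (e' := fun i => (ContinuousLinearMap.apply ℝ _ (EuclideanSpace.single i (1 : ℝ))).comp L')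
    (a := fun i => EuclideanSpace.single i (1 : ℝ)) (x := x) ?_
    (det_gram_coordVec_pos hu hi hx) (fun i j => hsymm _ _) ?_
  · intro i
    exact (ContinuousLinearMap.apply ℝ _ (EuclideanSpace.single i (1 : ℝ))).hasFDerivAt.comp x hL
  · rw [meanCurvature] at hmin
    rw [← hmin]
    refine Finset.sum_congr rfl fun i _ => Finset.sum_congr rfl fun j _ => ?_
    congr 2
    rw [coordHess, iteratedFDerivWithin_two_apply _ (𝓡∂ (m + 1)).uniqueDiffOn
      (extChartAt_target_subset_range c hx)]
    rfl

end Charts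

/-! ### Integration in the charts -/

section Charts

variable {m n : ℕ} {M : Type*} [TopologicalSpace M] [ChartedSpace (EuclideanHalfSpace (m + 1)) M]

/-- The integral of `h` over the chart centred at `c`, with respect to the Riemannian volume of the
metric induced by `u`. -/
def chartIntegral (m : ℕ) {n : ℕ} {M : Type*} [TopologicalSpace M]
    [ChartedSpace (EuclideanHalfSpace (m + 1)) M] (u : M → EuclideanSpace ℝ (Fin n)) (c : M)
    (h : M → ℝ) : ℝ :=
  ∫ x in (extChartAt (𝓡∂ (m + 1)) c).target,
    h ((extChartAt (𝓡∂ (m + 1)) c).symm x) * √(Matrix.gram ℝ (coordVec c u x)).det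

theorem sqrt_det_gram_coordVec (c : M) (u : M → EuclideanSpace ℝ (Fin n))
    (x : EuclideanSpace ℝ (Fin (m + 1))) :
    √(Matrix.gram ℝ (coordVec c u x)).det = (chartDeriv c u x).toLinearMap.normDet := by
  rw [normDet_eq_sqrt_det_gram _ (EuclideanSpace.basisFun (Fin (m + 1)) ℝ)]
  simp only [EuclideanSpace.basisFun_apply]
  rfl

theorem isCompact_chart_image {c : M} {Z : Set M} (hZ : IsCompact Z)
    (hZc : Z ⊆ (chartAt (EuclideanHalfSpace (m + 1)) c).source) :
    IsCompact (extChartAt (𝓡∂ (m + 1)) c '' Z) :=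
  hZ.image_of_continuousOn ((continuousOn_extChartAt c).mono (by rwa [extChartAt_source]))

theorem chart_image_subset_target {c : M} {Z : Set M}
    (hZc : Z ⊆ (chartAt (EuclideanHalfSpace (m + 1)) c).source) :
    extChartAt (𝓡∂ (m + 1)) c '' Z ⊆ (extChartAt (𝓡∂ (m + 1)) c).target := by
  rintro _ ⟨p, hp, rfl⟩
  exact (extChartAt _ c).map_source (by rw [extChartAt_source]; exact hZc hp)

theorem notMem_of_notMem_chart_image {c : M} {Z : Set M} {x : EuclideanSpace ℝ (Fin (m + 1))}
    (hx : x ∈ (extChartAt (𝓡∂ (m + 1)) c).target) (h : x ∉ extChartAt (𝓡∂ (m + 1)) c '' Z) :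
    (extChartAt (𝓡∂ (m + 1)) c).symm x ∉ Z := fun hp =>
  h ⟨_, hp, (extChartAt _ c).right_inv hx⟩

/-- A continuous function that vanishes off a compact subset of the domain of a chart is integrable
in that chart. -/
theorem integrableOn_chart {c : M} {Z : Set M} (hZ : IsCompact Z)
    (hZc : Z ⊆ (chartAt (EuclideanHalfSpace (m + 1)) c).source)
    {g : EuclideanSpace ℝ (Fin (m + 1)) → ℝ}
    (hg : ContinuousOn g (extChartAt (𝓡∂ (m + 1)) c).target)
    (h0 : ∀ x ∈ (extChartAt (𝓡∂ (m + 1)) c).target,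
      (extChartAt (𝓡∂ (m + 1)) c).symm x ∉ Z → g x = 0) :
    IntegrableOn g (extChartAt (𝓡∂ (m + 1)) c).target :=
  ((hg.mono (chart_image_subset_target hZc)).integrableOn_compact
    (isCompact_chart_image hZ hZc)).of_forall_sdiff_eq_zero (measurableSet_chart_target c)
    fun x hx => h0 x hx.1 (notMem_of_notMem_chart_image hx.1 hx.2)

variable [IsManifold (𝓡∂ (m + 1)) ∞ M] {u : M → EuclideanSpace ℝ (Fin n)}

/-- The integral of a function supported in the domains of two charts is the same in both. -/
theorem chartIntegral_eq_of_support
    (hu : ContMDiff (𝓡∂ (m + 1)) 𝓘(ℝ, EuclideanSpace ℝ (Fin n)) ∞ u) (c d : M) {h : M → ℝ}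
    (hc : ∀ p, p ∉ (chartAt (EuclideanHalfSpace (m + 1)) c).source → h p = 0)
    (hd : ∀ p, p ∉ (chartAt (EuclideanHalfSpace (m + 1)) d).source → h p = 0) :
    chartIntegral m u c h = chartIntegral m u d h := by
  set φ := extChartAt (𝓡∂ (m + 1)) c with hφ
  set ψ := extChartAt (𝓡∂ (m + 1)) d with hψ
  set s := φ.target ∩ φ.symm ⁻¹' (chartAt (EuclideanHalfSpace (m + 1)) d).source with hs
  set s' := ψ.target ∩ ψ.symm ⁻¹' (chartAt (EuclideanHalfSpace (m + 1)) c).source with hs'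
  have hsm : ∀ c d : M, MeasurableSet ((extChartAt (𝓡∂ (m + 1)) c).target ∩
      (extChartAt (𝓡∂ (m + 1)) c).symm ⁻¹'
        (chartAt (EuclideanHalfSpace (m + 1)) d).source) := by
    intro c d
    obtain ⟨O, hO, h⟩ := continuousOn_iff'.1 (continuousOn_extChartAt_symm (I := 𝓡∂ (m + 1)) c)
      (chartAt (EuclideanHalfSpace (m + 1)) d).source (chartAt _ d).open_source
    rw [inter_comm, h]
    exact hO.measurableSet.inter (measurableSet_chart_target c)
  have hred : ∀ c d : M, (∀ p, p ∉ (chartAt (EuclideanHalfSpace (m + 1)) d).source → h p = 0) →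
      chartIntegral m u c h = ∫ x in (extChartAt (𝓡∂ (m + 1)) c).target ∩
        (extChartAt (𝓡∂ (m + 1)) c).symm ⁻¹' (chartAt (EuclideanHalfSpace (m + 1)) d).source,
        h ((extChartAt (𝓡∂ (m + 1)) c).symm x) * √(Matrix.gram ℝ (coordVec c u x)).det := by
    intro c d hd
    refine setIntegral_eq_of_subset_of_forall_sdiff_eq_zero (measurableSet_chart_target c)
      inter_subset_left fun x hx => ?_
    rw [hd _ fun hp => hx.2 ⟨hx.1, hp⟩, zero_mul]
  rw [hred c d hd, hred d c hc]
  have hψs : ∀ x ∈ s, φ.symm x ∈ ψ.source := fun x hx => by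
    rw [hψ, extChartAt_source]; exact hx.2
  have himg : (ψ ∘ φ.symm) '' s = s' := by
    ext y
    constructor
    · rintro ⟨x, hx, rfl⟩
      refine ⟨ψ.map_source (hψs x hx), ?_⟩
      change ψ.symm (ψ (φ.symm x)) ∈ (chartAt (EuclideanHalfSpace (m + 1)) c).source
      rw [ψ.left_inv (hψs x hx), ← extChartAt_source (I := 𝓡∂ (m + 1))]
      exact φ.map_target hx.1
    · rintro ⟨hy, hyc⟩
      have hyφ : ψ.symm y ∈ φ.source := by rw [hφ, extChartAt_source]; exact hyc
      refine ⟨φ (ψ.symm y), ⟨φ.map_source hyφ, ?_⟩, ?_⟩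
      · change φ.symm (φ (ψ.symm y)) ∈ (chartAt (EuclideanHalfSpace (m + 1)) d).source
        rw [φ.left_inv hyφ, ← extChartAt_source (I := 𝓡∂ (m + 1))]
        exact ψ.map_target hy
      · rw [Function.comp_apply, φ.left_inv hyφ, ψ.right_inv hy]
  have hinj : InjOn (ψ ∘ φ.symm) s := by
    intro x hx y hy hxy
    exact φ.symm.injOn hx.1 hy.1 (ψ.injOn (hψs x hx) (hψs y hy) hxy)
  have hdiff : ∀ x ∈ s, HasFDerivWithinAt (ψ ∘ φ.symm)
      (fderivWithin ℝ (ψ ∘ φ.symm) (range (𝓡∂ (m + 1))) x) (range (𝓡∂ (m + 1))) x := by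
    intro x hx
    refine (ContDiffWithinAt.differentiableWithinAt (n := ∞) ?_ (by simp)).hasFDerivWithinAt
    refine contDiffWithinAt_ext_coord_change d c ?_
    rw [PartialEquiv.trans_source, PartialEquiv.symm_source]
    exact ⟨hx.1, hψs x hx⟩
  have hsR : s ⊆ range (𝓡∂ (m + 1)) := fun x hx => extChartAt_target_subset_range c hx.1
  rw [show (extChartAt (𝓡∂ (m + 1)) d).target ∩ (extChartAt (𝓡∂ (m + 1)) d).symm ⁻¹'
      (chartAt (EuclideanHalfSpace (m + 1)) c).source = (ψ ∘ φ.symm) '' s from himg.symm,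
    integral_image_eq_integral_abs_det_fderiv_smul volume (hsm c d)
      (fun x hx => (hdiff x hx).mono hsR) hinj]
  refine setIntegral_congr_fun (hsm c d) fun x hx => ?_
  have hx1 : ψ.symm ((ψ ∘ φ.symm) x) = φ.symm x := ψ.left_inv (hψs x hx)
  have hxT : (ψ ∘ φ.symm) x ∈ ψ.target := ψ.map_source (hψs x hx)
  have hchain : chartDeriv c u x = (chartDeriv d u ((ψ ∘ φ.symm) x)).comp
      (fderivWithin ℝ (ψ ∘ φ.symm) (range (𝓡∂ (m + 1))) x) := by
    have h1 : HasFDerivWithinAt ((u ∘ ψ.symm) ∘ (ψ ∘ φ.symm))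
        ((chartDeriv d u ((ψ ∘ φ.symm) x)).comp
        (fderivWithin ℝ (ψ ∘ φ.symm) (range (𝓡∂ (m + 1))) x)) s x :=
      (hasFDerivWithinAt_chartDeriv hu hxT).comp x ((hdiff x hx).mono hsR)
        fun y hy => extChartAt_target_subset_range d (ψ.map_source (hψs y hy))
    have h2 : HasFDerivWithinAt (u ∘ φ.symm) ((chartDeriv d u ((ψ ∘ φ.symm) x)).comp
        (fderivWithin ℝ (ψ ∘ φ.symm) (range (𝓡∂ (m + 1))) x)) s x :=
      h1.congr' (fun y hy => by
        change u (φ.symm y) = u (ψ.symm (ψ (φ.symm y)))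
        rw [ψ.left_inv (hψs y hy)]) hx
    have hsn : s ∈ 𝓝[range (𝓡∂ (m + 1))] x := by
      have h3 : φ.symm ⁻¹' (chartAt (EuclideanHalfSpace (m + 1)) d).source ∈ 𝓝[φ.target] x :=
        (continuousOn_extChartAt_symm c x hx.1).preimage_mem_nhdsWithin
          ((chartAt _ d).open_source.mem_nhds hx.2)
      exact inter_mem (extChartAt_target_mem_nhdsWithin_of_mem hx.1)
        (nhdsWithin_le_of_mem (extChartAt_target_mem_nhdsWithin_of_mem hx.1) h3)
    exact (h2.mono_of_mem_nhdsWithin hsn).fderivWithin (uniqueDiffWithinAt_chart hx.1)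
  -- The volume densities differ by the Jacobian of the coordinate change.
  have hJ : √(Matrix.gram ℝ (coordVec c u x)).det =
      √(Matrix.gram ℝ (coordVec d u ((ψ ∘ φ.symm) x))).det *
        |(fderivWithin ℝ (ψ ∘ φ.symm) (range (𝓡∂ (m + 1))) x).det| := by
    rw [sqrt_det_gram_coordVec, sqrt_det_gram_coordVec, hchain,
      ContinuousLinearMap.toLinearMap_comp,
      LinearMap.normDet_comp_of_finrank_eq _ _ rfl, LinearMap.normDet_eq_abs_det]
  change h (φ.symm x) * _ = _ • (h (ψ.symm ((ψ ∘ φ.symm) x)) * _)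
  rw [hJ, hx1, smul_eq_mul]
  ring

end Charts

/-! ### Measures given by a density in a chart -/

section Pieces

variable {E : Type*} [NormedAddCommGroup E] [MeasurableSpace E] [BorelSpace E]
  {μ : Measure E} [IsFiniteMeasureOnCompacts μ]
  {M : Type*} [TopologicalSpace M] [MeasurableSpace M] [BorelSpace M]

/-- Integration against the image of a measure with a continuous density `w ≥ 0` that is supported
in a compact subset `K` of the domain `T` of a parametrization `j`. -/
theorem integral_map_withDensity {T K : Set E} (hT : MeasurableSet T) (hK : IsCompact K)
    (hKT : K ⊆ T) {j : E → M} (hj : ContinuousOn j T) {w : E → ℝ} (hw : ContinuousOn w T)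
    (hw0 : ∀ x ∈ T, 0 ≤ w x) (hwK : ∀ x ∈ T, x ∉ K → w x = 0) {g : M → ℝ} (hg : Continuous g) :
    IsFiniteMeasure (((μ.restrict T).withDensity fun x => ENNReal.ofReal (w x)).map j) ∧
    ∫ p, g p ∂(((μ.restrict T).withDensity fun x => ENNReal.ofReal (w x)).map j) =
      ∫ x in T, w x * g (j x) ∂μ := by
  have hint : IntegrableOn w T μ :=
    ((hw.mono hKT).integrableOn_compact hK).of_forall_sdiff_eq_zero hT
      fun x hx => hwK x hx.1 hx.2
  have hfin : IsFiniteMeasure ((μ.restrict T).withDensity fun x => ENNReal.ofReal (w x)) :=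
    isFiniteMeasure_withDensity_ofReal hint.2
  have hjm : AEMeasurable j ((μ.restrict T).withDensity fun x => ENNReal.ofReal (w x)) :=
    (hj.aemeasurable hT).mono_ac (withDensity_absolutelyContinuous _ _)
  refine ⟨Measure.isFiniteMeasure_map _ _, ?_⟩
  rw [integral_map hjm hg.measurable.aestronglyMeasurable,
    integral_withDensity_eq_integral_toReal_smul₀ hint.aemeasurable.ennreal_ofReal
      (Eventually.of_forall fun _ => ENNReal.ofReal_lt_top)]
  refine setIntegral_congr_fun hT fun x hx => ?_
  simp only [ENNReal.toReal_ofReal (hw0 x hx), smul_eq_mul]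

/-- A sum of measures indexed by a type, all but finitely many of which vanish. -/
theorem integral_measure_sum_of_finset [CompactSpace M] {ι : Type*} {ν : ι → Measure M}
    {S : Finset ι}
    (hS : ∀ i ∉ S, ν i = 0) (hfin : ∀ i, IsFiniteMeasure (ν i)) {g : M → ℝ} (hg : Continuous g) :
    IsFiniteMeasure (Measure.sum ν) ∧
      ∫ p, g p ∂(Measure.sum ν) = ∑ i ∈ S, ∫ p, g p ∂(ν i) := by
  have h : Measure.sum ν = ∑ i ∈ S, ν i := by
    ext s hs
    rw [Measure.sum_apply _ hs, Measure.finsetSum_apply, tsum_eq_sum]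
    intro i hi
    rw [hS i hi]
    rfl
  rw [h]
  refine ⟨inferInstance, ?_⟩
  rw [integral_finsetSum_measure]
  intro i _
  exact hg.integrable_of_hasCompactSupport (HasCompactSupport.of_compactSpace g)

end Pieces

/-! ### The boundary in a chart -/

section Boundary

variable {m n : ℕ} {M : Type*} [TopologicalSpace M] [ChartedSpace (EuclideanHalfSpace (m + 1)) M]

/-- The inclusion of the boundary of the half-space, as a continuous linear map. -/
def toBoundaryL (m : ℕ) : EuclideanSpace ℝ (Fin m) →L[ℝ] EuclideanSpace ℝ (Fin (m + 1)) :=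
  LinearMap.toContinuousLinearMap
    { toFun := toBoundary m
      map_add' := fun y z => by
        ext i
        refine Fin.cases ?_ (fun j => ?_) i <;> simp [toBoundary]
      map_smul' := fun a y => by
        ext i
        refine Fin.cases ?_ (fun j => ?_) i <;> simp [toBoundary] }

theorem coe_toBoundaryL (m : ℕ) : ⇑(toBoundaryL m) = toBoundary m := rfl

theorem toBoundary_zero_apply (y : EuclideanSpace ℝ (Fin m)) : toBoundary m y 0 = 0 := rfl

theorem toBoundaryL_single (i : Fin m) :
    toBoundaryL m (EuclideanSpace.single i 1) = EuclideanSpace.single i.succ 1 := by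
  ext k
  refine Fin.cases ?_ (fun j => ?_) k
  · simp [coe_toBoundaryL, toBoundary, Fin.succ_ne_zero]
  · simp [coe_toBoundaryL, toBoundary, Pi.single_apply]

theorem isClosedEmbedding_toBoundary (m : ℕ) : Topology.IsClosedEmbedding (toBoundary m) := by
  refine Isometry.isClosedEmbedding (?_ : Isometry (toBoundaryL m))
  refine AddMonoidHomClass.isometry_of_norm _ fun y => ?_
  simp [EuclideanSpace.norm_eq, Fin.sum_univ_succ, coe_toBoundaryL, toBoundary]

theorem isOpen_preimage_toBoundary (c : M) :
    IsOpen (toBoundary m ⁻¹' (extChartAt (𝓡∂ (m + 1)) c).target) := by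
  obtain ⟨O, hO, h⟩ := exists_isOpen_chart_target (m := m) c
  rw [h, preimage_inter]
  have : toBoundary m ⁻¹' {x | 0 ≤ x 0} = univ := by
    ext y
    simp [toBoundary_zero_apply]
  rw [this, inter_univ]
  exact hO.preimage (isClosedEmbedding_toBoundary m).continuous

/-- The density `√det(⟨∂ᵢu, ∂ⱼu⟩)_{i, j ≠ 0}` of the volume of the boundary. -/
def boundaryDensity (c : M) (u : M → EuclideanSpace ℝ (Fin n)) (y : EuclideanSpace ℝ (Fin m)) : ℝ :=
  √(Matrix.gram ℝ fun i : Fin m => coordVec c u (toBoundary m y) i.succ).det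

theorem normDet_chartDeriv_comp_toBoundaryL (c : M) (u : M → EuclideanSpace ℝ (Fin n))
    (y : EuclideanSpace ℝ (Fin m)) :
    ((chartDeriv c u (toBoundary m y)).comp (toBoundaryL m)).toLinearMap.normDet =
      boundaryDensity c u y := by
  rw [normDet_eq_sqrt_det_gram _ (EuclideanSpace.basisFun (Fin m) ℝ)]
  simp only [EuclideanSpace.basisFun_apply, ContinuousLinearMap.toLinearMap_comp,
    LinearMap.comp_apply, ContinuousLinearMap.coe_coe, toBoundaryL_single, chartDeriv_single]
  rfl

variable [IsManifold (𝓡∂ (m + 1)) ∞ M]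

theorem mem_boundary_of_toBoundary {c : M} {y : EuclideanSpace ℝ (Fin m)}
    (hy : toBoundary m y ∈ (extChartAt (𝓡∂ (m + 1)) c).target) :
    (extChartAt (𝓡∂ (m + 1)) c).symm (toBoundary m y) ∈ (𝓡∂ (m + 1)).boundary M := by
  have hsrc : (extChartAt (𝓡∂ (m + 1)) c).symm (toBoundary m y) ∈
      (chartAt (EuclideanHalfSpace (m + 1)) c).source := by
    rw [← extChartAt_source (I := 𝓡∂ (m + 1))]
    exact (extChartAt _ c).map_target hy
  rw [← ModelWithCorners.compl_interior, mem_compl_iff, ModelWithCorners.interior, mem_ofPred_eq,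
    ModelWithCorners.isInteriorPoint_iff_of_mem_atlas (n := ∞) (by simp)
      (chart_mem_atlas _ c) hsrc]
  intro h
  have h1 := interior_mono (extChartAt_target_subset_range (I := 𝓡∂ (m + 1)) c) h
  rw [interior_range_modelWithCornersEuclideanHalfSpace] at h1
  have h2 : (extChartAt (𝓡∂ (m + 1)) c) ((extChartAt (𝓡∂ (m + 1)) c).symm (toBoundary m y)) =
      toBoundary m y := (extChartAt _ c).right_inv hy
  change 0 < (extChartAt (𝓡∂ (m + 1)) c) ((extChartAt (𝓡∂ (m + 1)) c).symm (toBoundary m y)) 0 at h1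
  rw [h2, toBoundary_zero_apply] at h1
  exact lt_irrefl _ h1

variable {u : M → EuclideanSpace ℝ (Fin n)}

theorem hasFDerivAt_inChart_toBoundary
    (hu : ContMDiff (𝓡∂ (m + 1)) 𝓘(ℝ, EuclideanSpace ℝ (Fin n)) ∞ u) {c : M}
    {y : EuclideanSpace ℝ (Fin m)} (hy : toBoundary m y ∈ (extChartAt (𝓡∂ (m + 1)) c).target) :
    HasFDerivAt (inChart c u ∘ toBoundary m)
      ((chartDeriv c u (toBoundary m y)).comp (toBoundaryL m)) y := by
  have h := (hasFDerivWithinAt_chartDeriv hu hy).comp (s := univ) y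
    ((toBoundaryL m).hasFDerivAt (x := y)).hasFDerivWithinAt (fun z _ => by
      rw [range_modelWithCornersEuclideanHalfSpace]
      exact (toBoundary_zero_apply z).ge)
  exact hasFDerivWithinAt_univ.1 h

theorem continuousOn_boundaryDensity
    (hu : ContMDiff (𝓡∂ (m + 1)) 𝓘(ℝ, EuclideanSpace ℝ (Fin n)) ∞ u) (c : M) :
    ContinuousOn (boundaryDensity (m := m) c u)
      (toBoundary m ⁻¹' (extChartAt (𝓡∂ (m + 1)) c).target) := by
  have h : ContinuousOn (fun x => √(Matrix.gram ℝ fun i : Fin m => coordVec c u x i.succ).det)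
      (extChartAt (𝓡∂ (m + 1)) c).target := by
    intro x hx
    have hij : ∀ i j : Fin m, ContDiffWithinAt ℝ ∞
        (fun x => inner ℝ (coordVec c u x i.succ) (coordVec c u x j.succ))
        (extChartAt (𝓡∂ (m + 1)) c).target x := fun i j =>
      (contDiffOn_coordVec hu c i.succ x hx).inner ℝ (contDiffOn_coordVec hu c j.succ x hx)
    have hd : ContDiffWithinAt ℝ ∞
        (fun x => (Matrix.gram ℝ fun i : Fin m => coordVec c u x i.succ).det)
        (extChartAt (𝓡∂ (m + 1)) c).target x := by
      refine ContDiffWithinAt.matrix_det fun i j => ?_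
      simp only [Matrix.gram_apply]
      exact hij i j
    exact hd.continuousWithinAt.sqrt
  exact h.comp (isClosedEmbedding_toBoundary m).continuous.continuousOn fun y hy => hy

end Boundary

/-! ### The divergence theorem on a free boundary minimal submanifold -/

section Stokes

variable {m n : ℕ} {M : Type*} [TopologicalSpace M] [ChartedSpace (EuclideanHalfSpace (m + 1)) M]
  [IsManifold (𝓡∂ (m + 1)) ∞ M] {u : M → EuclideanSpace ℝ (Fin n)}

theorem continuousOn_fluxFrame
    (hu : ContMDiff (𝓡∂ (m + 1)) 𝓘(ℝ, EuclideanSpace ℝ (Fin n)) ∞ u)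
    (hi : ∀ p, Function.Injective (mfderiv (𝓡∂ (m + 1)) 𝓘(ℝ, EuclideanSpace ℝ (Fin n)) u p))
    (c : M) (i : Fin (m + 1)) :
    ContinuousOn (fun x => fluxFrame (coordVec c u x) i) (extChartAt (𝓡∂ (m + 1)) c).target :=
  (contDiffOn_sqrt_det_gram hu hi c).continuousOn.smul (contDiffOn_dualFrame hu hi c i).continuousOn

/-- The flux of a vector field through the boundary: along the boundary of a free boundary
submanifold, the weighted dual frame points in the direction of the position vector. -/
theorem fluxFrame_zero_toBoundary (hu : IsFreeBoundaryMinimal (m := m) u) {c : M}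
    {y : EuclideanSpace ℝ (Fin m)} (hy : toBoundary m y ∈ (extChartAt (𝓡∂ (m + 1)) c).target) :
    fluxFrame (coordVec c u (toBoundary m y)) 0 =
      -(boundaryDensity c u y • u ((extChartAt (𝓡∂ (m + 1)) c).symm (toBoundary m y))) := by
  have hsrc : (extChartAt (𝓡∂ (m + 1)) c).symm (toBoundary m y) ∈
      (chartAt (EuclideanHalfSpace (m + 1)) c).source := by
    rw [← extChartAt_source (I := 𝓡∂ (m + 1))]
    exact (extChartAt _ c).map_target hy
  have h := hu.conormal c _ hsrc (mem_boundary_of_toBoundary hy)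
  rw [(extChartAt (𝓡∂ (m + 1)) c).right_inv hy] at h
  exact sqrt_det_gram_smul_dualFrame_zero (det_gram_coordVec_pos hu.smooth hu.immersion hy)
    h.norm_eq_one h.tangent h.normal_boundary h.outward

variable [CompactSpace M]

/-- The divergence theorem in a chart, for a linear vector field `A` of `ℝⁿ` cut off by a function
`ρ` supported in the chart. -/
theorem chartIntegral_divergence (hu : IsFreeBoundaryMinimal (m := m) u)
    (A : EuclideanSpace ℝ (Fin n) →L[ℝ] EuclideanSpace ℝ (Fin n)) {c : M} {ρ : M → ℝ}
    (hρ : ContMDiff (𝓡∂ (m + 1)) 𝓘(ℝ, ℝ) ∞ ρ)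
    (hρc : tsupport ρ ⊆ (chartAt (EuclideanHalfSpace (m + 1)) c).source) :
    chartIntegral m u c (tangentialDeriv m u (fun p => A (u p)) ρ) +
      (∫ x in (extChartAt (𝓡∂ (m + 1)) c).target, ρ ((extChartAt (𝓡∂ (m + 1)) c).symm x) *
        (∑ i, inner ℝ (A (coordVec c u x i)) (dualFrame (coordVec c u x) i)) *
          √(Matrix.gram ℝ (coordVec c u x)).det) =
      ∫ y in toBoundary m ⁻¹' (extChartAt (𝓡∂ (m + 1)) c).target,
        ρ ((extChartAt (𝓡∂ (m + 1)) c).symm (toBoundary m y)) * boundaryDensity c u y *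
          inner ℝ (A (u ((extChartAt (𝓡∂ (m + 1)) c).symm (toBoundary m y))))
            (u ((extChartAt (𝓡∂ (m + 1)) c).symm (toBoundary m y))) := by
  have hs := hu.smooth
  have hi := hu.immersion
  set φ := extChartAt (𝓡∂ (m + 1)) c with hφ
  set e := coordVec (m := m) c u with he
  have hZ : IsCompact (tsupport ρ) := (isClosed_tsupport ρ).isCompact
  have hρT : ContinuousOn (fun x => ρ (φ.symm x)) φ.target :=
    (contDiffOn_comp_chart_symm hρ c).continuousOn
  have huT : ContinuousOn (fun x => u (φ.symm x)) φ.target :=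
    (contDiffOn_comp_chart_symm hs c).continuousOn
  have hAu : ContinuousOn (fun x => A (u (φ.symm x))) φ.target := A.continuous.comp_continuousOn huT
  have hdρ : ∀ i, ContinuousOn (fun x => chartDeriv c ρ x (EuclideanSpace.single i (1 : ℝ)))
      φ.target := fun i => (contDiffOn_chartDeriv hρ c).continuousOn.clm_apply continuousOn_const
  have hflux := continuousOn_fluxFrame hs hi c
  have hAe : ∀ i, ContinuousOn (fun x => A (e x i)) φ.target := fun i =>
    A.continuous.comp_continuousOn (contDiffOn_coordVec hs c i).continuousOn
  have hρ0 : ∀ x ∈ φ.target, φ.symm x ∉ tsupport ρ → ρ (φ.symm x) = 0 := fun x _ h =>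
    image_eq_zero_of_notMem_tsupport h
  have hdρ0 : ∀ x ∈ φ.target, φ.symm x ∉ tsupport ρ → ∀ w, chartDeriv c ρ x w = 0 :=
    fun x hx h w => chartDeriv_eq_zero_of_notMem_tsupport hρ hx h w
  set D1 : EuclideanSpace ℝ (Fin (m + 1)) → ℝ := fun x =>
    ∑ i, inner ℝ (A (u (φ.symm x))) (fluxFrame (e x) i) *
      chartDeriv c ρ x (EuclideanSpace.single i (1 : ℝ)) with hD1
  set D2 : EuclideanSpace ℝ (Fin (m + 1)) → ℝ := fun x =>
    ∑ i, ρ (φ.symm x) * inner ℝ (A (e x i)) (fluxFrame (e x) i) with hD2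
  have hD1c : ContinuousOn D1 φ.target := continuousOn_finsetSum _ fun i _ =>
    (hAu.inner (𝕜 := ℝ) (hflux i)).mul (hdρ i)
  have hD2c : ContinuousOn D2 φ.target := continuousOn_finsetSum _ fun i _ =>
    hρT.mul ((hAe i).inner (𝕜 := ℝ) (hflux i))
  have hD10 : ∀ x ∈ φ.target, φ.symm x ∉ tsupport ρ → D1 x = 0 := fun x hx h =>
    Finset.sum_eq_zero fun i _ => by rw [hdρ0 x hx h, mul_zero]
  have hD20 : ∀ x ∈ φ.target, φ.symm x ∉ tsupport ρ → D2 x = 0 := fun x hx h =>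
    Finset.sum_eq_zero fun i _ => by rw [hρ0 x hx h, zero_mul]
  have hTm := measurableSet_chart_target (m := m) c
  have h1 : chartIntegral m u c (tangentialDeriv m u (fun p => A (u p)) ρ) =
      ∫ x in φ.target, D1 x := by
    refine setIntegral_congr_fun hTm fun x hx => ?_
    change tangentialDeriv m u (fun p => A (u p)) ρ (φ.symm x) * _ = D1 x
    rw [tangentialDeriv_chart hs hi hρ _ hx, hD1, Finset.sum_mul]
    refine Finset.sum_congr rfl fun i _ => ?_
    rw [fluxFrame, real_inner_smul_right]
    ring
  have h2 : (∫ x in φ.target, ρ (φ.symm x) * (∑ i, inner ℝ (A (e x i)) (dualFrame (e x) i)) *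
      √(Matrix.gram ℝ (e x)).det) = ∫ x in φ.target, D2 x := by
    refine setIntegral_congr_fun hTm fun x hx => ?_
    simp only [hD2, fluxFrame, real_inner_smul_right, Finset.mul_sum, Finset.sum_mul]
    refine Finset.sum_congr rfl fun i _ => ?_
    ring
  rw [h1, h2, ← integral_add (integrableOn_chart hZ hρc hD1c hD10)
    (integrableOn_chart hZ hρc hD2c hD20)]
  obtain ⟨O, hO, hT⟩ := exists_isOpen_chart_target (m := m) c
  set W : Fin (m + 1) → EuclideanSpace ℝ (Fin (m + 1)) → ℝ := fun i x =>
    ρ (φ.symm x) * inner ℝ (A (u (φ.symm x))) (fluxFrame (e x) i) with hW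
  have hK0 : ∀ {x}, x ∈ φ.target → x ∉ φ '' tsupport ρ → φ.symm x ∉ tsupport ρ := fun hx h =>
    notMem_of_notMem_chart_image hx h
  rw [integral_divergence_halfSpace hO hT (isCompact_chart_image hZ hρc)
    (chart_image_subset_target hρc) (W := W) (D := fun x => D1 x + D2 x)
    (fun i => hρT.mul (hAu.inner (𝕜 := ℝ) (hflux i))) (hD1c.add hD2c)
    (fun i x hx hxK => by rw [hW]; simp only [hρ0 x hx (hK0 hx hxK), zero_mul])
    (fun x hx hxK => by rw [hD10 x hx (hK0 hx hxK), hD20 x hx (hK0 hx hxK), add_zero]) ?_]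
  · rw [← integral_neg]
    refine setIntegral_congr_fun (isOpen_preimage_toBoundary c).measurableSet fun y hy => ?_
    simp only [hW, he, fluxFrame_zero_toBoundary hu hy, inner_neg_right, real_inner_smul_right]
    ring
  · intro x hx hx0
    have hsrc : φ.symm x ∈ (chartAt (EuclideanHalfSpace (m + 1)) c).source := by
      rw [← extChartAt_source (I := 𝓡∂ (m + 1))]
      exact φ.map_target hx
    have hmin := hu.minimal c _ hsrc
    rw [(extChartAt (𝓡∂ (m + 1)) c).right_inv hx] at hmin
    obtain ⟨Y', hY', hY0⟩ := hasFDerivAt_fluxFrame_coordVec hs hi hx hx0 hmin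
    have hρd := hasFDerivAt_chartDeriv hρ hx hx0
    have hud := A.hasFDerivAt.comp x (hasFDerivAt_chartDeriv hs hx hx0)
    refine ⟨_, fun i => hρd.mul (hud.inner ℝ (hY' i)), ?_⟩
    simp only [add_apply, smul_apply, ContinuousLinearMap.comp_apply, smul_eq_mul,
      ContinuousLinearMap.prod_apply, fderivInnerCLM_apply, Function.comp_apply,
      chartDeriv_single, mul_add, Finset.sum_add_distrib]
    have h3 : ∑ i, ρ (φ.symm x) * inner ℝ (A (u (φ.symm x)))
        (Y' i (EuclideanSpace.single i 1)) = 0 := by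
      rw [← Finset.mul_sum, ← inner_sum, hY0, inner_zero_right, mul_zero]
    rw [h3, zero_add, add_comm]

end Stokes

/-! ### Gluing by the partition of unity -/

section Global

variable {m n : ℕ} {M : Type*} [TopologicalSpace M] [ChartedSpace (EuclideanHalfSpace (m + 1)) M]
  [IsManifold (𝓡∂ (m + 1)) ∞ M] {u : M → EuclideanSpace ℝ (Fin n)}

/-- The linear vector field `x ↦ a ⟨x, v⟩ v - x`. -/
def stretchField {n : ℕ} (a : ℝ) (v : EuclideanSpace ℝ (Fin n)) :
    EuclideanSpace ℝ (Fin n) →L[ℝ] EuclideanSpace ℝ (Fin n) :=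
  a • (innerSL ℝ v).smulRight v - ContinuousLinearMap.id ℝ _

theorem stretchField_apply (a : ℝ) (v x : EuclideanSpace ℝ (Fin n)) :
    stretchField a v x = (a * inner ℝ x v) • v - x := by
  simp [stretchField, smul_smul, real_inner_comm]

theorem sum_inner_stretchField
    (hu : ContMDiff (𝓡∂ (m + 1)) 𝓘(ℝ, EuclideanSpace ℝ (Fin n)) ∞ u)
    (hi : ∀ p, Function.Injective (mfderiv (𝓡∂ (m + 1)) 𝓘(ℝ, EuclideanSpace ℝ (Fin n)) u p))
    {v : EuclideanSpace ℝ (Fin n)} (hv : ‖v‖ = 1) {c : M} {x : EuclideanSpace ℝ (Fin (m + 1))}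
    (hx : x ∈ (extChartAt (𝓡∂ (m + 1)) c).target) :
    ∑ i, inner ℝ (stretchField ((m : ℝ) + 1) v (coordVec c u x i)) (dualFrame (coordVec c u x) i) =
      -(((m : ℝ) + 1) * ‖normalPart m u ((extChartAt (𝓡∂ (m + 1)) c).symm x) v‖ ^ 2) := by
  have h := sum_inner_field_dualFrame (det_gram_coordVec_pos hu hi hx).ne' hv
  simp only [Fintype.card_fin, Nat.cast_add, Nat.cast_one] at h
  simp only [stretchField_apply, normalPart, ← span_coordVec hu hx]
  exact h

theorem continuous_norm_normalPart
    (hu : ContMDiff (𝓡∂ (m + 1)) 𝓘(ℝ, EuclideanSpace ℝ (Fin n)) ∞ u)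
    (hi : ∀ p, Function.Injective (mfderiv (𝓡∂ (m + 1)) 𝓘(ℝ, EuclideanSpace ℝ (Fin n)) u p))
    {v : EuclideanSpace ℝ (Fin n)} (hv : ‖v‖ = 1) :
    Continuous fun p => ‖normalPart m u p v‖ ^ 2 := by
  rw [continuous_iff_continuousAt]
  intro p
  have hm : (m : ℝ) + 1 ≠ 0 := by positivity
  have h1 : ContinuousOn (fun x => -((m : ℝ) + 1)⁻¹ *
      ∑ i, inner ℝ (stretchField ((m : ℝ) + 1) v (coordVec p u x i)) (dualFrame (coordVec p u x) i))
      (extChartAt (𝓡∂ (m + 1)) p).target :=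
    continuousOn_const.mul (continuousOn_finsetSum _ fun i _ =>
      ((stretchField ((m : ℝ) + 1) v).continuous.comp_continuousOn
        (contDiffOn_coordVec hu p i).continuousOn).inner (𝕜 := ℝ)
          (contDiffOn_dualFrame hu hi p i).continuousOn)
  have h2 := h1.comp (continuousOn_extChartAt (I := 𝓡∂ (m + 1)) p)
    fun q hq => (extChartAt (𝓡∂ (m + 1)) p).map_source hq
  refine ContinuousOn.continuousAt (h2.congr fun q hq => ?_) (extChartAt_source_mem_nhds p)
  simp only [Function.comp_apply]
  rw [sum_inner_stretchField hu hi hv ((extChartAt (𝓡∂ (m + 1)) p).map_source hq),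
    (extChartAt (𝓡∂ (m + 1)) p).left_inv hq]
  field_simp

variable [T2Space M] [CompactSpace M]

theorem exists_finset_chartPartition (m : ℕ) (M : Type*) [TopologicalSpace M]
    [ChartedSpace (EuclideanHalfSpace (m + 1)) M] [IsManifold (𝓡∂ (m + 1)) ∞ M] [T2Space M]
    [CompactSpace M] : ∃ S : Finset M, (∀ c ∉ S, ∀ p, chartPartition m M c p = 0) ∧
      ∀ p, ∑ c ∈ S, chartPartition m M c p = 1 := by
  have hfin := (chartPartition m M).locallyFinite.finite_nonempty_of_compact
  have h0 : ∀ c ∉ hfin.toFinset, ∀ p, chartPartition m M c p = 0 := by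
    intro c hc p
    by_contra h
    exact hc (hfin.mem_toFinset.2 ⟨p, h⟩)
  refine ⟨hfin.toFinset, h0, fun p => ?_⟩
  rw [← (chartPartition m M).sum_eq_one (mem_univ p)]
  refine (finsum_eq_sum_of_support_subset _ fun c hc => ?_).symm
  by_contra h
  exact hc (h0 c h p)

theorem tsupport_chartPartition_subset (c : M) :
    tsupport (chartPartition m M c) ⊆ (chartAt (EuclideanHalfSpace (m + 1)) c).source :=
  chartPartition_isSubordinate m c

/-- The derivatives of a partition of unity integrate to zero in total: in each chart their sum
vanishes, and a function supported in two charts has the same integral in both. -/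
theorem sum_chartIntegral_tangentialDeriv
    (hu : ContMDiff (𝓡∂ (m + 1)) 𝓘(ℝ, EuclideanSpace ℝ (Fin n)) ∞ u)
    (hi : ∀ p, Function.Injective (mfderiv (𝓡∂ (m + 1)) 𝓘(ℝ, EuclideanSpace ℝ (Fin n)) u p))
    {X : M → EuclideanSpace ℝ (Fin n)} (hX : Continuous X) {S : Finset M}
    (hS : ∀ p, ∑ c ∈ S, chartPartition m M c p = 1) :
    ∑ c ∈ S, chartIntegral m u c (tangentialDeriv m u X (chartPartition m M c)) = 0 := by
  set P : M → M → ℝ := fun c => chartPartition m M c with hP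
  have hPs : ∀ c, ContMDiff (𝓡∂ (m + 1)) 𝓘(ℝ, ℝ) ∞ (P c) := fun c =>
    (chartPartition m M c).contMDiff
  have hPt : ∀ c, tsupport (P c) ⊆ (chartAt (EuclideanHalfSpace (m + 1)) c).source :=
    tsupport_chartPartition_subset
  have hcpt : ∀ c, IsCompact (tsupport (P c)) := fun c => (isClosed_tsupport _).isCompact
  have hsrc : ∀ c p, p ∉ (chartAt (EuclideanHalfSpace (m + 1)) c).source → P c p = 0 :=
    fun c p hp => image_eq_zero_of_notMem_tsupport fun h => hp (hPt c h)
  have hb0 : ∀ c p, p ∉ tsupport (P c) → tangentialDeriv m u X (P c) p = 0 := fun c p hp => by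
    rw [tangentialDeriv, mfderiv_eq_zero_of_notMem_tsupport hp]
    rfl
  have hJ := fun d => (contDiffOn_sqrt_det_gram hu hi d).continuousOn
  have hbc : ∀ c d, ContinuousOn (fun x => tangentialDeriv m u X (P c)
      ((extChartAt (𝓡∂ (m + 1)) d).symm x)) (extChartAt (𝓡∂ (m + 1)) d).target := by
    intro c d
    refine ContinuousOn.congr ?_ fun x hx => tangentialDeriv_chart hu hi (hPs c) X hx
    refine continuousOn_finsetSum _ fun i _ => ContinuousOn.mul ?_ ?_
    · exact (hX.comp_continuousOn (continuousOn_extChartAt_symm d)).inner (𝕜 := ℝ)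
        (contDiffOn_dualFrame hu hi d i).continuousOn
    · exact (contDiffOn_chartDeriv (hPs c) d).continuousOn.clm_apply continuousOn_const
  have hPc : ∀ c d, ContinuousOn (fun x => P c ((extChartAt (𝓡∂ (m + 1)) d).symm x))
      (extChartAt (𝓡∂ (m + 1)) d).target := fun c d =>
    (contDiffOn_comp_chart_symm (hPs c) d).continuousOn
  have hi1 : ∀ c d, IntegrableOn (fun x => P d ((extChartAt (𝓡∂ (m + 1)) c).symm x) *
      tangentialDeriv m u X (P c) ((extChartAt (𝓡∂ (m + 1)) c).symm x) *
        √(Matrix.gram ℝ (coordVec c u x)).det) (extChartAt (𝓡∂ (m + 1)) c).target := fun c d =>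
    integrableOn_chart (hcpt c) (hPt c) (((hPc d c).mul (hbc c c)).mul (hJ c)) fun x hx h => by
      rw [hb0 c _ h, mul_zero, zero_mul]
  have hi2 : ∀ c d, IntegrableOn (fun x => P d ((extChartAt (𝓡∂ (m + 1)) d).symm x) *
      tangentialDeriv m u X (P c) ((extChartAt (𝓡∂ (m + 1)) d).symm x) *
        √(Matrix.gram ℝ (coordVec d u x)).det) (extChartAt (𝓡∂ (m + 1)) d).target := fun c d =>
    integrableOn_chart (hcpt d) (hPt d) (((hPc d d).mul (hbc c d)).mul (hJ d)) fun x hx h => by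
      rw [image_eq_zero_of_notMem_tsupport h, zero_mul, zero_mul]
  have h1 : ∀ c, chartIntegral m u c (tangentialDeriv m u X (P c)) =
      ∑ d ∈ S, chartIntegral m u c (fun p => P d p * tangentialDeriv m u X (P c) p) := by
    intro c
    simp only [chartIntegral]
    rw [← integral_finsetSum _ fun d _ => hi1 c d]
    refine integral_congr_ae (Eventually.of_forall fun x => ?_)
    simp only
    rw [← Finset.sum_mul, ← Finset.sum_mul, hS, one_mul]
  have h2 : ∀ c d, chartIntegral m u c (fun p => P d p * tangentialDeriv m u X (P c) p) =
      chartIntegral m u d (fun p => P d p * tangentialDeriv m u X (P c) p) := fun c d =>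
    chartIntegral_eq_of_support hu c d
      (fun p hp => by rw [hb0 c p fun h => hp (hPt c h), mul_zero])
      (fun p hp => by rw [hsrc d p hp, zero_mul])
  calc ∑ c ∈ S, chartIntegral m u c (tangentialDeriv m u X (P c)) =
      ∑ d ∈ S, ∑ c ∈ S, chartIntegral m u d (fun p => P d p * tangentialDeriv m u X (P c) p) := by
        rw [Finset.sum_comm]
        refine Finset.sum_congr rfl fun c _ => ?_
        rw [h1]
        exact Finset.sum_congr rfl fun d _ => h2 c d
    _ = 0 := by
        refine Finset.sum_eq_zero fun d _ => ?_
        simp only [chartIntegral]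
        rw [← integral_finsetSum _ fun c _ => hi2 c d]
        refine setIntegral_eq_zero_of_forall_eq_zero fun x hx => ?_
        rw [← Finset.sum_mul, ← Finset.mul_sum]
        -- The partition functions add up to `1`, so their derivatives add up to `0`.
        have h3 : ∑ c ∈ S,
            tangentialDeriv m u X (P c) ((extChartAt (𝓡∂ (m + 1)) d).symm x) = 0 := by
          simp only [tangentialDeriv_chart hu hi (hPs _) X hx]
          rw [Finset.sum_comm]
          refine Finset.sum_eq_zero fun i _ => ?_
          rw [← Finset.mul_sum]
          have h4 : HasFDerivWithinAt (fun _ : EuclideanSpace ℝ (Fin (m + 1)) => (1 : ℝ))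
              (∑ c ∈ S, chartDeriv d (P c) x) (range (𝓡∂ (m + 1))) x := by
            refine (HasFDerivWithinAt.fun_sum fun c _ =>
              hasFDerivWithinAt_chartDeriv (hPs c) hx).congr_of_eventuallyEq
              (Eventually.of_forall fun y => ?_) ?_
            · simp only [Function.comp_apply, hP, hS]
            · simp only [Function.comp_apply, hP, hS]
          have h5 := (uniqueDiffWithinAt_chart hx).eq h4
            (hasFDerivWithinAt_const (1 : ℝ) x (range (𝓡∂ (m + 1))))
          have h6 := congrArg (fun T : EuclideanSpace ℝ (Fin (m + 1)) →L[ℝ] ℝ =>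
            T (EuclideanSpace.single i 1)) h5
          simp only [sum_apply] at h6
          rw [h6]
          simp
        rw [h3, mul_zero, zero_mul]

variable [MeasurableSpace M] [BorelSpace M]

theorem integral_volumeMeasure
    (hu : ContMDiff (𝓡∂ (m + 1)) 𝓘(ℝ, EuclideanSpace ℝ (Fin n)) ∞ u)
    (hi : ∀ p, Function.Injective (mfderiv (𝓡∂ (m + 1)) 𝓘(ℝ, EuclideanSpace ℝ (Fin n)) u p))
    {S : Finset M} (hS : ∀ c ∉ S, ∀ p, chartPartition m M c p = 0) {g : M → ℝ}
    (hg : Continuous g) :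
    ∫ p, g p ∂(volumeMeasure m u) = ∑ c ∈ S, ∫ x in (extChartAt (𝓡∂ (m + 1)) c).target,
      (chartPartition m M c ((extChartAt (𝓡∂ (m + 1)) c).symm x) *
        √(Matrix.gram ℝ (coordVec c u x)).det) * g ((extChartAt (𝓡∂ (m + 1)) c).symm x) := by
  have hpiece := fun c : M => integral_map_withDensity (μ := volume) (measurableSet_chart_target c)
    (isCompact_chart_image (isClosed_tsupport (chartPartition m M c)).isCompact
      (tsupport_chartPartition_subset c))
    (chart_image_subset_target (tsupport_chartPartition_subset c))
    (continuousOn_extChartAt_symm (I := 𝓡∂ (m + 1)) c)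
    (w := fun x => chartPartition m M c ((extChartAt (𝓡∂ (m + 1)) c).symm x) *
        √(Matrix.gram ℝ (coordVec c u x)).det)
    ((contDiffOn_comp_chart_symm (chartPartition m M c).contMDiff c).continuousOn.mul
      (contDiffOn_sqrt_det_gram hu hi c).continuousOn)
    (fun x _ => mul_nonneg ((chartPartition m M).nonneg c _) (Real.sqrt_nonneg _))
    (fun x hx hxK => by
      simp only [image_eq_zero_of_notMem_tsupport (notMem_of_notMem_chart_image hx hxK), zero_mul])
    hg
  have heq : volumeMeasure m u = Measure.sum fun c : M =>
      ((volume.restrict (extChartAt (𝓡∂ (m + 1)) c).target).withDensity fun x =>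
        ENNReal.ofReal (chartPartition m M c ((extChartAt (𝓡∂ (m + 1)) c).symm x) *
          √(Matrix.gram ℝ (coordVec c u x)).det)).map (extChartAt (𝓡∂ (m + 1)) c).symm := by
    simp only [sqrt_det_gram_coordVec]
    rfl
  rw [heq, (integral_measure_sum_of_finset (S := S) (fun c hc => ?_) (fun c => (hpiece c).1) hg).2]
  · exact Finset.sum_congr rfl fun c _ => (hpiece c).2
  · simp [hS c hc]

/-- Integration over the boundary, for a density that is a multiple of the volume density of the
boundary by a continuous function. -/
theorem integral_boundary_density
    (hu : ContMDiff (𝓡∂ (m + 1)) 𝓘(ℝ, EuclideanSpace ℝ (Fin n)) ∞ u)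
    {S : Finset M} (hS : ∀ c ∉ S, ∀ p, chartPartition m M c p = 0)
    {r : M → ℝ} (hr : Continuous r) (hr0 : ∀ p, 0 ≤ r p)
    {w : EuclideanSpace ℝ (Fin n) → EuclideanSpace ℝ (Fin n)}
    (hw : ∀ c : M, ∀ y, toBoundary m y ∈ (extChartAt (𝓡∂ (m + 1)) c).target →
      (fderiv ℝ (inChart c (w ∘ u) ∘ toBoundary m) y).toLinearMap.normDet =
        boundaryDensity c u y * r ((extChartAt (𝓡∂ (m + 1)) c).symm (toBoundary m y)))
    {g : M → ℝ} (hg : Continuous g) :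
    IsFiniteMeasure (boundaryMeasure (M := M) m (w ∘ u)) ∧
    ∫ p, g p ∂(boundaryMeasure m (w ∘ u)) =
      ∑ c ∈ S, ∫ y in toBoundary m ⁻¹' (extChartAt (𝓡∂ (m + 1)) c).target,
        chartPartition m M c ((extChartAt (𝓡∂ (m + 1)) c).symm (toBoundary m y)) *
          boundaryDensity c u y * (r ((extChartAt (𝓡∂ (m + 1)) c).symm (toBoundary m y)) *
            g ((extChartAt (𝓡∂ (m + 1)) c).symm (toBoundary m y))) := by
  have hB : ∀ c : M, MeasurableSet (toBoundary m ⁻¹' (extChartAt (𝓡∂ (m + 1)) c).target) :=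
    fun c => (isOpen_preimage_toBoundary c).measurableSet
  have hj : ∀ c : M, ContinuousOn ((extChartAt (𝓡∂ (m + 1)) c).symm ∘ toBoundary m)
      (toBoundary m ⁻¹' (extChartAt (𝓡∂ (m + 1)) c).target) := fun c =>
    (continuousOn_extChartAt_symm (I := 𝓡∂ (m + 1)) c).comp
      (isClosedEmbedding_toBoundary m).continuous.continuousOn fun y hy => hy
  have hpiece := fun c : M => integral_map_withDensity (μ := volume) (hB c)
    ((isClosedEmbedding_toBoundary m).isCompact_preimage
      (isCompact_chart_image (isClosed_tsupport (chartPartition m M c)).isCompact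
        (tsupport_chartPartition_subset c)))
    (preimage_mono (chart_image_subset_target (tsupport_chartPartition_subset c)))
    (hj c)
    (w := fun y => chartPartition m M c ((extChartAt (𝓡∂ (m + 1)) c).symm (toBoundary m y)) *
        (boundaryDensity c u y * r ((extChartAt (𝓡∂ (m + 1)) c).symm (toBoundary m y))))
    (((chartPartition m M c).contMDiff.continuous.comp_continuousOn (hj c)).mul
      ((continuousOn_boundaryDensity hu c).mul (hr.comp_continuousOn (hj c))))
    (fun y _ => mul_nonneg ((chartPartition m M).nonneg c _)
      (mul_nonneg (Real.sqrt_nonneg _) (hr0 _)))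
    (fun y hy hyK => by
      simp only [image_eq_zero_of_notMem_tsupport (notMem_of_notMem_chart_image hy hyK), zero_mul])
    hg
  have heq : boundaryMeasure m (w ∘ u) = Measure.sum fun c : M =>
      ((volume.restrict (toBoundary m ⁻¹' (extChartAt (𝓡∂ (m + 1)) c).target)).withDensity fun y =>
        ENNReal.ofReal
          (chartPartition m M c ((extChartAt (𝓡∂ (m + 1)) c).symm (toBoundary m y)) *
            (boundaryDensity c u y *
              r ((extChartAt (𝓡∂ (m + 1)) c).symm (toBoundary m y))))).map
      ((extChartAt (𝓡∂ (m + 1)) c).symm ∘ toBoundary m) := by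
    rw [boundaryMeasure]
    congr 1
    funext c
    congr 1
    refine withDensity_congr_ae ?_
    filter_upwards [ae_restrict_mem (hB c)] with y hy
    rw [hw c y hy]
  have hsum := integral_measure_sum_of_finset (S := S) (ν := fun c : M =>
      ((volume.restrict (toBoundary m ⁻¹' (extChartAt (𝓡∂ (m + 1)) c).target)).withDensity fun y =>
        ENNReal.ofReal
          (chartPartition m M c ((extChartAt (𝓡∂ (m + 1)) c).symm (toBoundary m y)) *
            (boundaryDensity c u y *
              r ((extChartAt (𝓡∂ (m + 1)) c).symm (toBoundary m y))))).map
      ((extChartAt (𝓡∂ (m + 1)) c).symm ∘ toBoundary m)) (fun c hc => by simp [hS c hc])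
      (fun c => (hpiece c).1) hg
  rw [heq]
  refine ⟨hsum.1, ?_⟩
  rw [hsum.2]
  refine Finset.sum_congr rfl fun c _ => ?_
  rw [(hpiece c).2]
  refine integral_congr_ae (Eventually.of_forall fun y => ?_)
  simp only [Function.comp_apply]
  ring

theorem integral_boundaryMeasure
    (hu : ContMDiff (𝓡∂ (m + 1)) 𝓘(ℝ, EuclideanSpace ℝ (Fin n)) ∞ u)
    {S : Finset M} (hS : ∀ c ∉ S, ∀ p, chartPartition m M c p = 0) {g : M → ℝ}
    (hg : Continuous g) :
    IsFiniteMeasure (boundaryMeasure (M := M) m u) ∧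
    ∫ p, g p ∂(boundaryMeasure m u) =
      ∑ c ∈ S, ∫ y in toBoundary m ⁻¹' (extChartAt (𝓡∂ (m + 1)) c).target,
        chartPartition m M c ((extChartAt (𝓡∂ (m + 1)) c).symm (toBoundary m y)) *
          boundaryDensity c u y * g ((extChartAt (𝓡∂ (m + 1)) c).symm (toBoundary m y)) := by
  have h := integral_boundary_density hu hS (r := fun _ => 1) continuous_const
    (fun _ => zero_le_one) (w := id) (fun c y hy => by
      rw [Function.id_comp, (hasFDerivAt_inChart_toBoundary hu hy).fderiv,
        normDet_chartDeriv_comp_toBoundaryL, mul_one]) hg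
  simpa only [Function.id_comp, one_mul] using h

/-- The first variation identity for the vector field `k ⟨x, v⟩ v - x`. -/
theorem integral_boundary_eq_neg_integral_normalPart (hu : IsFreeBoundaryMinimal (m := m) u)
    {v : EuclideanSpace ℝ (Fin n)} (hv : ‖v‖ = 1) :
    ∫ p, inner ℝ (stretchField ((m : ℝ) + 1) v (u p)) (u p) ∂(boundaryMeasure m u) =
      -((m : ℝ) + 1) * ∫ p, ‖normalPart m u p v‖ ^ 2 ∂(volumeMeasure m u) := by
  obtain ⟨S, hS, hS1⟩ := exists_finset_chartPartition m M
  have hs := hu.smooth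
  have hi := hu.immersion
  have hc : Continuous u := hs.continuous
  have hA : Continuous fun p => stretchField ((m : ℝ) + 1) v (u p) :=
    (stretchField ((m : ℝ) + 1) v).continuous.comp hc
  have hN : Continuous fun p => -((m : ℝ) + 1) * ‖normalPart m u p v‖ ^ 2 :=
    continuous_const.mul (continuous_norm_normalPart hs hi hv)
  rw [(integral_boundaryMeasure hs hS
    (hA.inner hc)).2, ← integral_const_mul,
    integral_volumeMeasure hs hi hS hN,
    ← zero_add (∑ c ∈ S, ∫ x in (extChartAt (𝓡∂ (m + 1)) c).target, _),
    ← sum_chartIntegral_tangentialDeriv hs hi hA hS1, ← Finset.sum_add_distrib]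
  refine Finset.sum_congr rfl fun c _ => ?_
  refine (chartIntegral_divergence hu (stretchField ((m : ℝ) + 1) v)
    (chartPartition m M c).contMDiff (tsupport_chartPartition_subset c)).symm.trans ?_
  congr 1
  refine setIntegral_congr_fun (measurableSet_chart_target c) fun x hx => ?_
  simp only [sum_inner_stretchField hs hi hv hx]
  ring

end Global

/-! ### The conformal flow on the sphere -/

section ConformalFlow

variable {n : ℕ} {v : EuclideanSpace ℝ (Fin n)}

theorem contDiff_conformalField (v : EuclideanSpace ℝ (Fin n)) :
    ContDiff ℝ 1 (conformalField v) := by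
  unfold conformalField
  have h1 : ContDiff ℝ 1 fun x : EuclideanSpace ℝ (Fin n) => ‖x‖ ^ 2 := contDiff_norm_sq ℝ
  have h2 : ContDiff ℝ 1 fun x : EuclideanSpace ℝ (Fin n) => (inner ℝ x v : ℝ) :=
    contDiff_id.inner ℝ contDiff_const
  exact (((contDiff_const.add h1).div_const 2).smul contDiff_const).sub (h2.smul contDiff_id)

/-- The flow is unique: on a bounded time interval two trajectories stay in a bounded set, where
the field is Lipschitz. -/
theorem IsConformalFlow.eq_of_mem {f g : ℝ → EuclideanSpace ℝ (Fin n) → EuclideanSpace ℝ (Fin n)}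
    (hf : IsConformalFlow v f) (hg : IsConformalFlow v g) {x : EuclideanSpace ℝ (Fin n)}
    (hx : x ∈ closedBall (0 : EuclideanSpace ℝ (Fin n)) 1) (t : ℝ) : f t x = g t x := by
  set a : ℝ := |t| + 1
  have hcf : Continuous fun s => f s x :=
    continuous_iff_continuousAt.2 fun s => (hf.hasDerivAt x hx s).continuousAt
  have hcg : Continuous fun s => g s x :=
    continuous_iff_continuousAt.2 fun s => (hg.hasDerivAt x hx s).continuousAt
  have hK : IsCompact ((fun s => f s x) '' Icc (-a) a ∪ (fun s => g s x) '' Icc (-a) a) :=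
    (isCompact_Icc.image hcf).union (isCompact_Icc.image hcg)
  obtain ⟨L, hL⟩ := ((contDiff_conformalField v).locallyLipschitz.locallyLipschitzOn
    (s := (fun s => f s x) '' Icc (-a) a ∪
      (fun s => g s x) '' Icc (-a) a)).exists_lipschitzOnWith_of_compact hK
  have hta : t ∈ Ioo (-a) a := by
    rw [mem_Ioo, ← abs_lt]
    exact lt_add_one _
  have ha : (0 : ℝ) ∈ Ioo (-a) a := by
    have : 0 < a := by positivity
    exact ⟨by linarith, this⟩
  exact ODE_solution_unique_of_mem_Ioo (v := fun _ => conformalField v) (K := L)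
    (s := fun _ => (fun s => f s x) '' Icc (-a) a ∪ (fun s => g s x) '' Icc (-a) a)
    (fun _ _ => hL) ha
    (fun s hs => ⟨hf.hasDerivAt x hx s, Or.inl ⟨s, Ioo_subset_Icc_self hs, rfl⟩⟩)
    (fun s hs => ⟨hg.hasDerivAt x hx s, Or.inr ⟨s, Ioo_subset_Icc_self hs, rfl⟩⟩)
    (by rw [hf.zero x hx, hg.zero x hx]) hta

theorem cosh_add_mul_sinh_pos (t : ℝ) {s : ℝ} (hs : |s| ≤ 1) :
    0 < Real.cosh t + s * Real.sinh t := by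
  have h1 : |Real.sinh t| < Real.cosh t :=
    abs_lt_of_sq_lt_sq (by linarith [Real.cosh_sq t]) (Real.cosh_pos t).le
  have h2 : |s * Real.sinh t| ≤ |Real.sinh t| := by
    rw [abs_mul]
    exact mul_le_of_le_one_left (abs_nonneg _) hs
  linarith [neg_abs_le (s * Real.sinh t)]

theorem abs_inner_le_one (hv : ‖v‖ = 1) {x : EuclideanSpace ℝ (Fin n)} (hx : ‖x‖ ≤ 1) :
    |(inner ℝ x v : ℝ)| ≤ 1 :=
  (abs_real_inner_le_norm x v).trans (by rw [hv, mul_one]; exact hx)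

theorem flowDen_of_norm_eq_one (t : ℝ) {x : EuclideanSpace ℝ (Fin n)} (hx : ‖x‖ = 1) :
    flowDen v t x = Real.cosh t + inner ℝ x v * Real.sinh t := by
  rw [flowDen, hx]
  ring

theorem flowNum_of_norm_eq_one (t : ℝ) {x : EuclideanSpace ℝ (Fin n)} (hx : ‖x‖ = 1) :
    flowNum v t x = x + (Real.sinh t + inner ℝ x v * (Real.cosh t - 1)) • v := by
  rw [flowNum, hx]
  congr 2
  ring

/-- The flow scales the metric of a submanifold `z` of the unit sphere by the conformal factor
`(cosh t + ⟨z, v⟩ sinh t)⁻²`. -/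
theorem exists_hasFDerivAt_flow_comp (hv : ‖v‖ = 1) (t : ℝ) {Y : Type*} [NormedAddCommGroup Y]
    [NormedSpace ℝ Y] {z : Y → EuclideanSpace ℝ (Fin n)} {z' : Y →L[ℝ] EuclideanSpace ℝ (Fin n)}
    {y : Y} (hz : HasFDerivAt z z' y) (h1 : ∀ᶠ y' in 𝓝 y, ‖z y'‖ = 1) :
    ∃ T : Y →L[ℝ] EuclideanSpace ℝ (Fin n),
      HasFDerivAt (fun y' => (flowDen v t (z y'))⁻¹ • flowNum v t (z y')) T y ∧
      ∀ a b, inner ℝ (T a) (T b) =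
        ((Real.cosh t + inner ℝ (z y) v * Real.sinh t)⁻¹) ^ 2 * inner ℝ (z' a) (z' b) := by
  have hzy : ‖z y‖ = 1 := h1.self_of_nhds
  have hDpos := cosh_add_mul_sinh_pos t (abs_inner_le_one hv hzy.le)
  set D : ℝ := Real.cosh t + inner ℝ (z y) v * Real.sinh t with hD
  set N : EuclideanSpace ℝ (Fin n) :=
    z y + (Real.sinh t + inner ℝ (z y) v * (Real.cosh t - 1)) • v with hN
  -- The submanifold lies in the sphere, so its tangent vectors are orthogonal to the position.
  have horth : ∀ a, inner ℝ (z y) (z' a) = (0 : ℝ) := by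
    intro a
    have h2 : HasFDerivAt (fun y' => (inner ℝ (z y') (z y') : ℝ)) _ y := hz.inner ℝ hz
    have h3 : HasFDerivAt (fun y' => (inner ℝ (z y') (z y') : ℝ)) (0 : Y →L[ℝ] ℝ) y := by
      refine (hasFDerivAt_const (1 : ℝ) y).congr_of_eventuallyEq ?_
      filter_upwards [h1] with y' hy'
      rw [real_inner_self_eq_norm_sq, hy', one_pow]
    have h4 := congrArg (fun T : Y →L[ℝ] ℝ => T a) (h2.unique h3)
    simp only [ContinuousLinearMap.comp_apply, ContinuousLinearMap.prod_apply,
      fderivInnerCLM_apply, zero_apply, real_inner_comm (z y) (z' a)] at h4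
    linarith
  have hl : HasFDerivAt (fun y' => (inner ℝ (z y') v : ℝ)) ((innerSL ℝ v).comp z') y := by
    refine ((innerSL ℝ v).hasFDerivAt.comp y hz).congr_of_eventuallyEq
      (Eventually.of_forall fun y' => ?_)
    simp [real_inner_comm]
  have hden : HasFDerivAt (fun y' => Real.cosh t + inner ℝ (z y') v * Real.sinh t)
      (Real.sinh t • (innerSL ℝ v).comp z') y := (hl.mul_const (Real.sinh t)).const_add _
  have hnum : HasFDerivAt
      (fun y' => z y' + (Real.sinh t + inner ℝ (z y') v * (Real.cosh t - 1)) • v)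
      (z' + ((Real.cosh t - 1) • (innerSL ℝ v).comp z').smulRight v) y :=
    hz.add (((hl.mul_const (Real.cosh t - 1)).const_add _).smul_const v)
  have hq := ((hasDerivAt_inv hDpos.ne').comp_hasFDerivAt y hden).smul hnum
  refine ⟨_, hq.congr_of_eventuallyEq ?_, ?_⟩
  · filter_upwards [h1] with y' hy'
    rw [flowDen_of_norm_eq_one t hy', flowNum_of_norm_eq_one t hy']
    rfl
  intro a b
  have hT : ∀ a, (((fun y => y⁻¹) ∘ fun y' => Real.cosh t + inner ℝ (z y') v * Real.sinh t) y •
        (z' + ((Real.cosh t - 1) • (innerSL ℝ v).comp z').smulRight v) +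
      (-(D ^ 2)⁻¹ • Real.sinh t • (innerSL ℝ v).comp z').smulRight N) a =
      D⁻¹ • (z' a + ((Real.cosh t - 1) * inner ℝ v (z' a)) • v) -
        ((D⁻¹) ^ 2 * Real.sinh t * inner ℝ v (z' a)) • N := by
    intro a
    simp [← hD]
    module
  rw [hT, hT]
  have hc := Real.cosh_sq t
  have hvv : inner ℝ v v = (1 : ℝ) := by rw [real_inner_self_eq_norm_sq, hv, one_pow]
  have hzz : inner ℝ (z y) (z y) = (1 : ℝ) := by rw [real_inner_self_eq_norm_sq, hzy, one_pow]
  have hNN : inner ℝ N N = D ^ 2 := by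
    rw [hN, hD, real_inner_add_add_self]
    simp only [real_inner_smul_left, real_inner_smul_right, hvv, hzz]
    linear_combination ((inner ℝ (z y) v) ^ 2 - 1) * hc
  have hNa : ∀ a, inner ℝ N (z' a + ((Real.cosh t - 1) * inner ℝ v (z' a)) • v) =
      inner ℝ v (z' a) * Real.sinh t * D := by
    intro a
    rw [hN, hD]
    simp only [inner_add_left, inner_add_right, real_inner_smul_left, real_inner_smul_right, hvv,
      horth]
    linear_combination (inner ℝ v (z' a) * inner ℝ (z y) v) * hc
  have hab : inner ℝ (z' a + ((Real.cosh t - 1) * inner ℝ v (z' a)) • v)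
      (z' b + ((Real.cosh t - 1) * inner ℝ v (z' b)) • v) =
      inner ℝ (z' a) (z' b) + Real.sinh t ^ 2 * (inner ℝ v (z' a) * inner ℝ v (z' b)) := by
    simp only [inner_add_left, inner_add_right, real_inner_smul_left, real_inner_smul_right, hvv,
      real_inner_comm v (z' a)]
    linear_combination (inner ℝ v (z' a) * inner ℝ v (z' b)) * hc
  rw [inner_sub_left, inner_sub_right, inner_sub_right]
  simp only [real_inner_smul_left, real_inner_smul_right, hab, hNa, hNN,
    real_inner_comm N (z' a + ((Real.cosh t - 1) * inner ℝ v (z' a)) • v)]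
  field_simp
  ring

end ConformalFlow

/-- A linear map whose Gram form is that of `f` scaled by `r²` has volume factor scaled by `rᵈ`. -/
theorem normDet_eq_pow_mul_of_inner {U V : Type*} [NormedAddCommGroup U] [InnerProductSpace ℝ U]
    [FiniteDimensional ℝ U] [NormedAddCommGroup V] [InnerProductSpace ℝ V] {f g : U →ₗ[ℝ] V}
    {r : ℝ} (hr : 0 ≤ r) (h : ∀ a b, inner ℝ (g a) (g b) = r ^ 2 * inner ℝ (f a) (f b)) :
    g.normDet = r ^ Module.finrank ℝ U * f.normDet := by
  have b := stdOrthonormalBasis ℝ U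
  rw [normDet_eq_sqrt_det_gram g b, normDet_eq_sqrt_det_gram f b]
  have h1 : (Matrix.gram ℝ fun i => g (b i)) = r ^ 2 • Matrix.gram ℝ fun i => f (b i) := by
    ext i j
    simp [Matrix.gram_apply, h]
  rw [h1, Matrix.det_smul, Fintype.card_fin, ← pow_mul, mul_comm 2, pow_mul,
    Real.sqrt_mul (sq_nonneg _), Real.sqrt_sq (pow_nonneg hr _)]

/-! ### Differentiation of the boundary volume -/

/-- Differentiation under the integral sign, for an integrand that depends on the point through a
continuous function with values in `[-1, 1]`. -/
theorem hasDerivAt_integral_comp {M : Type*} [TopologicalSpace M] [MeasurableSpace M]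
    [BorelSpace M] {σ : Measure M} [IsFiniteMeasure σ] {φ : M → ℝ} (hφ : Continuous φ)
    (hφ1 : ∀ p, |φ p| ≤ 1) {F F' : ℝ → ℝ → ℝ}
    (hF : ContinuousOn (Function.uncurry F) (univ ×ˢ Icc (-1) 1))
    (hF' : ContinuousOn (Function.uncurry F') (univ ×ˢ Icc (-1) 1))
    (hd : ∀ t s, |s| ≤ 1 → HasDerivAt (fun t => F t s) (F' t s) t) (t : ℝ) :
    HasDerivAt (fun t => ∫ p, F t (φ p) ∂σ) (∫ p, F' t (φ p) ∂σ) t := by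
  have hc : ∀ {G : ℝ → ℝ → ℝ}, ContinuousOn (Function.uncurry G) (univ ×ˢ Icc (-1) 1) →
      ∀ t, Continuous fun p => G t (φ p) := by
    intro G hG t
    exact hG.comp_continuous (f := fun p => (t, φ p)) (by fun_prop)
      fun p => ⟨mem_univ _, abs_le.1 (hφ1 p)⟩
  have hb : ∀ {G : ℝ → ℝ → ℝ}, ContinuousOn (Function.uncurry G) (univ ×ˢ Icc (-1) 1) →
      ∃ C, ∀ t' ∈ Icc (t - 1) (t + 1), ∀ p, ‖G t' (φ p)‖ ≤ C := by
    intro G hG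
    obtain ⟨C, hC⟩ := (isCompact_Icc.prod isCompact_Icc).exists_bound_of_continuousOn
      (hG.mono (prod_mono (subset_univ (Icc (t - 1) (t + 1))) Subset.rfl))
    exact ⟨C, fun t' ht' p => hC (t', φ p) ⟨ht', abs_le.1 (hφ1 p)⟩⟩
  obtain ⟨C, hC⟩ := hb hF
  obtain ⟨C', hC'⟩ := hb hF'
  refine (hasDerivAt_integral_of_dominated_loc_of_deriv_le (s := Icc (t - 1) (t + 1))
    (F' := fun t p => F' t (φ p)) (bound := fun _ => C') (Icc_mem_nhds (by linarith) (by linarith))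
    (Eventually.of_forall fun t' => (hc hF t').measurable.aestronglyMeasurable)
    (Integrable.of_bound (hc hF t).measurable.aestronglyMeasurable C
      (Eventually.of_forall fun p => hC t ⟨by linarith, by linarith⟩ p))
    (hc hF' t).measurable.aestronglyMeasurable
    (Eventually.of_forall fun p t' ht' => hC' t' ht' p) (integrable_const _)
    (Eventually.of_forall fun p t' _ => hd t' (φ p) (hφ1 p))).2

section Variation

theorem continuousOn_cosh_add_inv_pow (k : ℕ) :
    ContinuousOn (Function.uncurry fun t s : ℝ => (Real.cosh t + s * Real.sinh t)⁻¹ ^ k)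
      (univ ×ˢ Icc (-1) 1) := by
  refine (ContinuousOn.inv₀ ?_ fun z hz => ?_).pow k
  · exact ((Real.continuous_cosh.comp continuous_fst).add
      (continuous_snd.mul (Real.continuous_sinh.comp continuous_fst))).continuousOn
  · exact (cosh_add_mul_sinh_pos z.1 (abs_le.2 hz.2)).ne'

theorem hasDerivAt_cosh_add (t s : ℝ) :
    HasDerivAt (fun t => Real.cosh t + s * Real.sinh t) (Real.sinh t + s * Real.cosh t) t :=
  (Real.hasDerivAt_cosh t).add ((Real.hasDerivAt_sinh t).const_mul s)

theorem hasDerivAt_cosh_add_inv_pow (k : ℕ) (t : ℝ) {s : ℝ} (hs : |s| ≤ 1) :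
    HasDerivAt (fun t => (Real.cosh t + s * Real.sinh t)⁻¹ ^ k)
      (-(k : ℝ) * (Real.cosh t + s * Real.sinh t)⁻¹ ^ (k + 1) *
        (Real.sinh t + s * Real.cosh t)) t := by
  have hne := (cosh_add_mul_sinh_pos t hs).ne'
  refine (((hasDerivAt_cosh_add t s).inv hne).pow k).congr_deriv ?_
  rcases k with _ | k
  · simp
  · simp only [Pi.inv_apply, Nat.add_sub_cancel]
    rw [div_eq_mul_inv, ← inv_pow]
    ring

theorem hasDerivAt_deriv_cosh_add_inv_pow (k : ℕ) (t : ℝ) {s : ℝ} (hs : |s| ≤ 1) :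
    HasDerivAt (fun t => -(k : ℝ) * (Real.cosh t + s * Real.sinh t)⁻¹ ^ (k + 1) *
        (Real.sinh t + s * Real.cosh t))
      ((k : ℝ) * (k + 1) * (Real.cosh t + s * Real.sinh t)⁻¹ ^ (k + 2) *
        (Real.sinh t + s * Real.cosh t) ^ 2 -
        k * (Real.cosh t + s * Real.sinh t)⁻¹ ^ (k + 1) *
          (Real.cosh t + s * Real.sinh t)) t := by
  have h := ((hasDerivAt_cosh_add_inv_pow (k + 1) t hs).const_mul (-(k : ℝ))).mul
    ((Real.hasDerivAt_sinh t).add ((Real.hasDerivAt_cosh t).const_mul s))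
  refine h.congr_deriv ?_
  simp only [Pi.add_apply]
  push_cast
  ring

variable {m n : ℕ} {M : Type*} [TopologicalSpace M] [ChartedSpace (EuclideanHalfSpace (m + 1)) M]
  [IsManifold (𝓡∂ (m + 1)) ∞ M] {u : M → EuclideanSpace ℝ (Fin n)}
  {v : EuclideanSpace ℝ (Fin n)} {f : ℝ → EuclideanSpace ℝ (Fin n) → EuclideanSpace ℝ (Fin n)}

/-- The volume density of the boundary moved by the flow. -/
theorem normDet_fderiv_flow_comp (hu : IsFreeBoundaryMinimal (m := m) u) (hv : ‖v‖ = 1)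
    (hf : IsConformalFlow v f) (t : ℝ) (c : M) {y : EuclideanSpace ℝ (Fin m)}
    (hy : toBoundary m y ∈ (extChartAt (𝓡∂ (m + 1)) c).target) :
    (fderiv ℝ (inChart c (f t ∘ u) ∘ toBoundary m) y).toLinearMap.normDet =
      boundaryDensity c u y * (Real.cosh t +
        inner ℝ (u ((extChartAt (𝓡∂ (m + 1)) c).symm (toBoundary m y))) v * Real.sinh t)⁻¹ ^ m := by
  have hz := hasFDerivAt_inChart_toBoundary hu.smooth hy
  have h1 : ∀ᶠ y' in 𝓝 y, ‖(inChart c u ∘ toBoundary m) y'‖ = 1 := by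
    filter_upwards [(isOpen_preimage_toBoundary c).mem_nhds hy] with y' hy'
    exact mem_sphere_zero_iff_norm.1 (hu.mem_sphere _ (mem_boundary_of_toBoundary hy'))
  obtain ⟨T, hT, hTab⟩ := exists_hasFDerivAt_flow_comp hv t hz h1
  have heq : inChart c (f t ∘ u) ∘ toBoundary m = fun y' =>
      (flowDen v t ((inChart c u ∘ toBoundary m) y'))⁻¹ •
        flowNum v t ((inChart c u ∘ toBoundary m) y') := by
    funext y'
    exact hf.eq_of_mem (isConformalFlow_explicit hv) (hu.mem_ball _) t
  have hpos := cosh_add_mul_sinh_pos t (abs_inner_le_one hv h1.self_of_nhds.le)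
  rw [heq, hT.fderiv, normDet_eq_pow_mul_of_inner (inv_nonneg.2 hpos.le) hTab,
    normDet_chartDeriv_comp_toBoundaryL, finrank_euclideanSpace_fin, mul_comm]
  rfl

variable [T2Space M] [CompactSpace M] [MeasurableSpace M] [BorelSpace M]

/-- The volume of the boundary moved by the flow, as an integral over the original boundary. -/
theorem boundaryVolume_flow (hu : IsFreeBoundaryMinimal (m := m) u) (hv : ‖v‖ = 1)
    (hf : IsConformalFlow v f) (t : ℝ) :
    boundaryVolume m (f t ∘ u) =
      ∫ p, (Real.cosh t + inner ℝ (u p) v * Real.sinh t)⁻¹ ^ m ∂(boundaryMeasure m u) := by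
  obtain ⟨S, hS, -⟩ := exists_finset_chartPartition m M
  have huv : ∀ p, |(inner ℝ (u p) v : ℝ)| ≤ 1 := fun p =>
    abs_inner_le_one hv (by simpa using hu.mem_ball p)
  have hφ : Continuous fun p => (inner ℝ (u p) v : ℝ) := hu.smooth.continuous.inner continuous_const
  have hr : Continuous fun p => (Real.cosh t + inner ℝ (u p) v * Real.sinh t)⁻¹ ^ m :=
    ((continuous_const.add (hφ.mul continuous_const)).inv₀
      fun p => (cosh_add_mul_sinh_pos t (huv p)).ne').pow m
  have h := integral_boundary_density hu.smooth hS hr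
    (fun p => pow_nonneg (inv_nonneg.2 (cosh_add_mul_sinh_pos t (huv p)).le) m)
    (w := f t) (fun c y hy => normDet_fderiv_flow_comp hu hv hf t c hy)
    (g := fun _ => 1) continuous_const
  have h2 := h.2
  rw [integral_const, smul_eq_mul, mul_one] at h2
  rw [boundaryVolume, h2, (integral_boundaryMeasure hu.smooth hS hr).2]
  simp only [mul_one]

/-- The second derivative of the conformal factor integrates to the flux of the field
`k ⟨x, v⟩ v - x` through the boundary, where `|u| = 1`. -/
theorem integral_second_variation (hu : IsFreeBoundaryMinimal (m := m) u) (hv : ‖v‖ = 1) :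
    ∫ p, ((m : ℝ) * (m + 1) * inner ℝ (u p) v ^ 2 - m) ∂(boundaryMeasure m u) =
      -((m : ℝ) * (m + 1)) * ∫ p, ‖normalPart m u p v‖ ^ 2 ∂(volumeMeasure m u) := by
  obtain ⟨S, hS, -⟩ := exists_finset_chartPartition m M
  have hc : Continuous u := hu.smooth.continuous
  have hφ : Continuous fun p => (inner ℝ (u p) v : ℝ) := hc.inner continuous_const
  have hg : Continuous fun p => ((m : ℝ) * (m + 1) * inner ℝ (u p) v ^ 2 - m) := by fun_prop
  have hA : Continuous fun p => (m : ℝ) * inner ℝ (stretchField ((m : ℝ) + 1) v (u p)) (u p) :=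
    continuous_const.mul (((stretchField ((m : ℝ) + 1) v).continuous.comp hc).inner hc)
  have h1 : ∫ p, ((m : ℝ) * (m + 1) * inner ℝ (u p) v ^ 2 - m) ∂(boundaryMeasure m u) =
      ∫ p, (m : ℝ) * inner ℝ (stretchField ((m : ℝ) + 1) v (u p)) (u p)
        ∂(boundaryMeasure m u) := by
    rw [(integral_boundaryMeasure hu.smooth hS hg).2, (integral_boundaryMeasure hu.smooth hS hA).2]
    refine Finset.sum_congr rfl fun c _ => ?_
    refine setIntegral_congr_fun (isOpen_preimage_toBoundary c).measurableSet fun y hy => ?_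
    have hsph := hu.mem_sphere _ (mem_boundary_of_toBoundary hy)
    rw [mem_sphere_zero_iff_norm] at hsph
    simp only [stretchField_apply, inner_sub_left, real_inner_smul_left,
      real_inner_self_eq_norm_sq, hsph, real_inner_comm _ v]
    ring
  rw [h1, integral_const_mul, integral_boundary_eq_neg_integral_normalPart hu hv]
  ring

end Variation

end FreeBoundary

end

theorem mainTheorem5 {m n : ℕ} {M : Type*} [TopologicalSpace M]
    [ChartedSpace (EuclideanHalfSpace (m + 1)) M] [IsManifold (𝓡∂ (m + 1)) ∞ M]
    [T2Space M] [CompactSpace M] [MeasurableSpace M] [BorelSpace M]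
    (u : M → EuclideanSpace ℝ (Fin n)) (hu : FreeBoundary.IsFreeBoundaryMinimal (m := m) u)
    (v : EuclideanSpace ℝ (Fin n)) (hv : ‖v‖ = 1)
    (f : ℝ → EuclideanSpace ℝ (Fin n) → EuclideanSpace ℝ (Fin n))
    (hf : FreeBoundary.IsConformalFlow v f) :
    Differentiable ℝ (fun t => FreeBoundary.boundaryVolume m (f t ∘ u)) ∧
    HasDerivAt (deriv fun t => FreeBoundary.boundaryVolume m (f t ∘ u))
      (-((m : ℝ) * (m + 1)) *
        ∫ p, ‖FreeBoundary.normalPart m u p v‖ ^ 2 ∂FreeBoundary.volumeMeasure m u) 0 ∧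
    -((m : ℝ) * (m + 1)) *
        ∫ p, ‖FreeBoundary.normalPart m u p v‖ ^ 2 ∂FreeBoundary.volumeMeasure m u ≤ 0 := by
  open FreeBoundary in
  obtain ⟨S, hS, -⟩ := exists_finset_chartPartition m M
  have hfin := (integral_boundaryMeasure hu.smooth hS (g := fun _ => 0) continuous_const).1
  have huv : ∀ p, |(inner ℝ (u p) v : ℝ)| ≤ 1 := fun p =>
    abs_inner_le_one hv (by simpa using hu.mem_ball p)
  have hφ : Continuous fun p => (inner ℝ (u p) v : ℝ) := hu.smooth.continuous.inner continuous_const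
  have hV : (fun t => boundaryVolume m (f t ∘ u)) = fun t =>
      ∫ p, (Real.cosh t + inner ℝ (u p) v * Real.sinh t)⁻¹ ^ m ∂(boundaryMeasure m u) :=
    funext fun t => boundaryVolume_flow hu hv hf t
  have hp := continuousOn_cosh_add_inv_pow
  have hC : Continuous fun z : ℝ × ℝ => Real.cosh z.1 + z.2 * Real.sinh z.1 :=
    (Real.continuous_cosh.comp continuous_fst).add
      (continuous_snd.mul (Real.continuous_sinh.comp continuous_fst))
  have hC' : Continuous fun z : ℝ × ℝ => Real.sinh z.1 + z.2 * Real.cosh z.1 :=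
    (Real.continuous_sinh.comp continuous_fst).add
      (continuous_snd.mul (Real.continuous_cosh.comp continuous_fst))
  have hC1 : ContinuousOn (Function.uncurry fun t s : ℝ =>
      -(m : ℝ) * (Real.cosh t + s * Real.sinh t)⁻¹ ^ (m + 1) * (Real.sinh t + s * Real.cosh t))
      (univ ×ˢ Icc (-1) 1) := (continuousOn_const.mul (hp (m + 1))).mul hC'.continuousOn
  have hC2 : ContinuousOn (Function.uncurry fun t s : ℝ =>
      (m : ℝ) * (m + 1) * (Real.cosh t + s * Real.sinh t)⁻¹ ^ (m + 2) *
        (Real.sinh t + s * Real.cosh t) ^ 2 -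
        m * (Real.cosh t + s * Real.sinh t)⁻¹ ^ (m + 1) * (Real.cosh t + s * Real.sinh t))
      (univ ×ˢ Icc (-1) 1) :=
    ((continuousOn_const (c := (m : ℝ) * (m + 1)).mul (hp (m + 2))).mul
      (hC'.continuousOn.pow 2)).sub
      ((continuousOn_const (c := (m : ℝ)).mul (hp (m + 1))).mul hC.continuousOn)
  have h1 := hasDerivAt_integral_comp (σ := boundaryMeasure m u) hφ huv (hp m)
    hC1 (fun t s hs => hasDerivAt_cosh_add_inv_pow m t hs)
  have h2 := hasDerivAt_integral_comp (σ := boundaryMeasure m u) hφ huv hC1 hC2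
    (fun t s hs => hasDerivAt_deriv_cosh_add_inv_pow m t hs) 0
  rw [hV]
  refine ⟨fun t => (h1 t).differentiableAt, ?_, ?_⟩
  · rw [funext fun t => (h1 t).deriv, ← integral_second_variation hu hv]
    refine h2.congr_deriv (integral_congr_ae (Eventually.of_forall fun p => ?_))
    simp
  · have hm : (0 : ℝ) ≤ (m : ℝ) * (m + 1) := by positivity
    have hI : 0 ≤ ∫ p, ‖normalPart m u p v‖ ^ 2 ∂(volumeMeasure m u) :=
      integral_nonneg fun p => by positivity
    nlinarith [mul_nonneg hm hI]
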